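/- Let $m\ge 3$ and $n=2^m-1$. For $1\le i\le m$ let $v_i\in\mathbb F_2^{2^m}$ be the vector whose entry in column $c\in\{0,\dots,2^m-1\}$ is the binary digit of weight $2^{i-1}$ of $c$. Let $\overline{\mathsf G}(r,m)$ (the generator matrix of the shortened Reed–Muller code) have as rows the componentwise products $\prod_{i\in T}v_i$, $\emptyset\ne T\subseteq\{1,\dots,m\}$, $|T|\le r$, with the column $c=0$ deleted. The quantum Reed–Muller code $QRM(1,m)$ is the stabilizer code on $n$ qubits whose stabilizer group $\mathscr S$ is generated by the operators obtained from the rows of $\overline{\mathsf G}(1,m)$ by replacing $1$ by $X$ and $0$ by $I$, and from the rows of $\overline{\mathsf G}(m-2,m)$ by replacing $1$ by $Z$ and $0$ by $I$. Let $\Pi$ be the orthogonal projection onto the code space, $G=\sum_{1\le i<j<k\le n}Z_iZ_jZ_k$ and $G_{\mathrm{eff}}=\Pi G\Pi$. Then: 1. $QRM(1,m)$ is an $[[n,1,3]]$ code, and $\overline Z=Z^{\otimes n}$ is a (nontrivial) logical operator of it. 2. Exactly $n(n-1)/6$ of the representatives $\overline Z Q$, $Q\in\mathscr S$, of the logical $Z$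 have weight $3$, and exactly $n(n-1)/6$ of the terms $Z_iZ_jZ_k$ of $G$ are (nontrivial) logical operators. 3. There are Pauli corrections, one for each syndrome, such that the following holds for every Hamiltonian $H=\omega G+H_0$ with $\omega\in\mathbb R$ and $H_0$ a $2$-local Hermitian operator and for all finite families of Lindblad operators $L_a$ each acting on a single qubit. Let the evolution by $\frac{d\rho}{dt}=-i[H,\rho]+\sum_a\bigl(L_a\rho L_a^\dagger-\tfrac12\{L_a^\dagger L_a,\rho\}\bigr)$ from an initial density operator $\rho_0=\Pi\rho_0\Pi$ be interrupted at the times $t/N,2t/N,\dots,t$ by a measurement of the syndrome followed by the correction. Then, as $N\to\infty$, the state at time $t\ge0$ converges to $\rho_\omega(t)$, the solution of $\frac{d\rho}{dt}=-i\omega[G_{\mathrm{eff}},\rho]$, $\rho(0)=\rho_0$. 4. For all $\omega\in\mathbb R$ and $t\ge 0$, the quantum Fisher information of $\rho_\omega(t)$ about $\omega$, maximized over the initial density operators $\rho_0=\Pi\rho_0\Pi$ on the code space, is attained and equals $$F(\rho_\omega(t))=\frac{n^2(n-1)^2t^2}{9}=\Theta(n^4t^2),$$ where the constants in $\Theta$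 do not depend on $m,\omega,t$. -/

import Mathlib

open scoped Matrix Matrix.Norms.L2Operator Topology ComplexOrder

noncomputable section

namespace QRM

/-! ### Reed–Muller generator matrices -/

/-- The generator matrix `G(r,m)` of the Reed–Muller code `RM(r,m)`. The row `v_i` (`i = 1,…,m`)
is `(0,…,0,1,…,1,0,…,0,…,1,…,1)` with blocks of length `2^(i-1)`: its entry in column `c`
(counted from `0`) is the binary digit of weight `2^(i-1)` of `c`. A row of `G(r,m)` is
the Boolean product of the `v_i`, `i ∈ T`, for a set `T` of at most `r` indices; `T = ∅` gives the
all-ones row `v_0`. -/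
def rmGen (r m : ℕ) : Matrix {T : Finset (Fin m) // T.card ≤ r} (Fin (2 ^ m)) (ZMod 2) :=
  fun T c => if ∀ i ∈ T.1, (c : ℕ).testBit (i : ℕ) = true then 1 else 0

/-- The rows of `G(r,m)` other than the all-ones row. -/
abbrev ShortRow (r m : ℕ) : Type := {T : Finset (Fin m) // T.Nonempty ∧ T.card ≤ r}

/-- The generator matrix of the shortened Reed–Muller code: `G(r,m)` without its
first (all-ones) row and without its first column. -/
def shortGen (r m : ℕ) : Matrix (ShortRow r m) (Fin (2 ^ m - 1)) (ZMod 2) :=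
  fun T j => rmGen r m ⟨T.1, T.2.2⟩ ⟨(j : ℕ) + 1, by have := j.2; omega⟩

/-! ### Qubits and Pauli operators -/

/-- Operators on `n` qubits, as matrices in the computational basis. -/
abbrev Op (n : ℕ) : Type := Matrix (Fin n → ZMod 2) (Fin n → ZMod 2) ℂ

/-- The tensor product with a factor `X` where `a i = 1` and a factor `I` elsewhere:
`|y⟩ ↦ |y + a⟩`. -/
def pauliX {n : ℕ} (a : Fin n → ZMod 2) : Op n :=
  Matrix.of fun x y => if x = y + a then 1 else 0

/-- The tensor product with a factor `Z` where `b i = 1` and a factor `I` elsewhere: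
`|x⟩ ↦ (-1)^(b·x) |x⟩`. -/
def pauliZ {n : ℕ} (b : Fin n → ZMod 2) : Op n :=
  Matrix.diagonal fun x => ∏ i, if b i = 1 ∧ x i = 1 then (-1 : ℂ) else 1

/-- The number of tensor factors of `X^a Z^b` that are not the identity. -/
def weight {n : ℕ} (a b : Fin n → ZMod 2) : ℕ :=
  (Finset.univ.filter fun i => a i ≠ 0 ∨ b i ≠ 0).card

/-- Membership in the `n`-qubit Pauli group `{±1, ±i} × {I, X, Y, Z}^{⊗ n}` (with `Y = i X Z`),
for an element with exactly `w` tensor factors different from the identity. -/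
def IsPauliOfWeight {n : ℕ} (w : ℕ) (P : Op n) : Prop :=
  ∃ (k : ℕ) (a b : Fin n → ZMod 2), weight a b = w ∧ P = Complex.I ^ k • (pauliX a * pauliZ b)

/-- Membership in the `n`-qubit Pauli group. -/
def IsPauli {n : ℕ} (P : Op n) : Prop := ∃ w, IsPauliOfWeight w P

/-- The product of the `Z_i`, `i ∈ T`. -/
def zString {n : ℕ} (T : Finset (Fin n)) : Op n := pauliZ fun i => if i ∈ T then 1 else 0

/-! ### Stabilizer codes -/

section Stabilizer

variable {n : ℕ} {ι : Type} (g : ι → Op n)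

/-- The group generated by the generators `g`. Pauli operators have finite order, so the monoid they
generate is a group. -/
def stabilizer : Submonoid (Op n) := Submonoid.closure (Set.range g)

/-- The simultaneous eigenspace of the generators with eigenvalues `(-1)^(s j)`. -/
def syndromeSpace (s : ι → ZMod 2) : Submodule ℂ (EuclideanSpace ℂ (Fin n → ZMod 2)) :=
  ⨅ j, Module.End.eigenspace (Matrix.toEuclideanLin (g j)) (if s j = 0 then 1 else -1)

/-- The orthogonal projection onto the eigenspace of the syndrome `s`. -/
def syndromeProj (s : ι → ZMod 2) : Op n :=
  Matrix.toEuclideanLin.symm (syndromeSpace g s).starProjection.toLinearMap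

/-- The code space: the vectors fixed by all stabilizers. -/
def codeSpace : Submodule ℂ (EuclideanSpace ℂ (Fin n → ZMod 2)) := syndromeSpace g 0

/-- The orthogonal projection `Π` onto the code space. -/
def codeProj : Op n := syndromeProj g 0

/-- (Nontrivial) logical operators: Pauli operators that normalize the stabilizer group, that is,
commute with all of it, and that do not belong to it, whatever phase they are given. -/
def IsLogical (P : Op n) : Prop :=
  IsPauli P ∧ (∀ Q ∈ stabilizer g, Commute P Q) ∧ ∀ k : ℕ, Complex.I ^ k • P ∉ stabilizer g

/-- The Pauli operators `g` generate the stabilizer of an `[[n, k, d]]` code. -/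
def IsStabilizerCode (k d : ℕ) : Prop :=
  (∀ j, IsPauli (g j)) ∧ (∀ i j, Commute (g i) (g j)) ∧ (-1 : Op n) ∉ stabilizer g ∧
    Module.finrank ℂ (codeSpace g) = 2 ^ k ∧
    IsLeast {w | ∃ P, IsPauliOfWeight w P ∧ IsLogical g P} d

end Stabilizer

/-- The stabilizer generators of `QRM(1,m)`: `X`-type ones from the rows of the shortened generator
matrix of `RM(1,m)`, `Z`-type ones from those of the shortened generator matrix of `RM(m-2,m)`. -/
def qrm (m : ℕ) : ShortRow 1 m ⊕ ShortRow (m - 2) m → Op (2 ^ m - 1)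
  | Sum.inl T => pauliX (shortGen 1 m T)
  | Sum.inr T => pauliZ (shortGen (m - 2) m T)

/-- The logical `Z` operator `Z^{⊗ n}` of `QRM(1,m)`. -/
def logicalZ (m : ℕ) : Op (2 ^ m - 1) := pauliZ 1

/-! ### Master equation and error correction -/

section Dynamics

variable {n : ℕ}

/-- The operators acting only on the qubits in `s`. -/
def supportedOn (s : Finset (Fin n)) : Submodule ℂ (Op n) :=
  Submodule.span ℂ {P | ∃ a b : Fin n → ZMod 2,
    (∀ i ∉ s, a i = 0 ∧ b i = 0) ∧ P = pauliX a * pauliZ b}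

/-- The `k`-local operators: sums of operators each acting on at most `k` qubits. -/
def localOps (n k : ℕ) : Submodule ℂ (Op n) :=
  ⨆ (s : Finset (Fin n)) (_ : s.card ≤ k), supportedOn s

/-- The fully connected interaction `G = ∑_{i<j<k} Z_i Z_j Z_k`. -/
def zzz (n : ℕ) : Op n := ∑ T ∈ Finset.powersetCard 3 Finset.univ, zString T

/-- The superoperator `ρ ↦ A ρ B`. -/
def sandwich (A B : Op n) : Op n →ₗ[ℂ] Op n := LinearMap.mulLeft ℂ A ∘ₗ LinearMap.mulRight ℂ B

/-- The right-hand side `ρ ↦ -i [H, ρ] + ∑_a (L_a ρ L_a† - {L_a† L_a, ρ} / 2)` of the Lindblad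
master equation. -/
def lindbladian (H : Op n) {q : ℕ} (L : Fin q → Op n) : Op n →ₗ[ℂ] Op n :=
  (-Complex.I) • (sandwich H 1 - sandwich 1 H) +
    ∑ a, (sandwich (L a) (L a)ᴴ -
      (1 / 2 : ℂ) • (sandwich ((L a)ᴴ * L a) 1 + sandwich 1 ((L a)ᴴ * L a)))

/-- The solution at time `t` of `dρ/dt = 𝓛 ρ` with initial value `ρ₀`. -/
def evolve (𝓛 : Op n →ₗ[ℂ] Op n) (t : ℝ) (ρ₀ : Op n) : Op n :=
  NormedSpace.exp (t • LinearMap.toContinuousLinearMap 𝓛) ρ₀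

/-- One round of error correction: measure the syndrome `s` of the stabilizer generators `g`
and apply the correction `C s`. -/
def recovery {ι : Type} [Fintype ι] [DecidableEq ι] (g : ι → Op n) (C : (ι → ZMod 2) → Op n) :
    Op n →ₗ[ℂ] Op n :=
  ∑ s, sandwich (C s * syndromeProj g s) (C s * syndromeProj g s)ᴴ

/-- The state at time `t` when the evolution generated by `𝓛` is interrupted by the
control operation `R` at the `N` times `t/N, 2t/N, …, t`. -/
def controlled (R 𝓛 : Op n →ₗ[ℂ] Op n) (t : ℝ) (N : ℕ) (ρ₀ : Op n) : Op n :=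
  (fun ρ => R (evolve 𝓛 (t / N) ρ))^[N] ρ₀

/-- The generator `ρ ↦ -i ω [Π G Π, ρ]` of the evolution of code states in the limit
of fast error correction. -/
def effGenerator {ι : Type} (g : ι → Op n) (ω : ℝ) : Op n →ₗ[ℂ] Op n :=
  lindbladian (ω • (codeProj g * zzz n * codeProj g)) (q := 0) Fin.elim0

/-- Density operators on the code space. -/
def IsCodeState {ι : Type} (g : ι → Op n) (ρ : Op n) : Prop :=
  ρ.PosSemidef ∧ ρ.trace = 1 ∧ codeProj g * ρ * codeProj g = ρ

/-- `F` is the quantum Fisher information at `ω` of the family of states `ρ`: `F = Tr(ρ L²)`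
for a symmetric logarithmic derivative `L`, that is, a Hermitian `L` such that
`dρ/dω = (L ρ + ρ L) / 2`. -/
def HasQFI (ρ : ℝ → Op n) (ω F : ℝ) : Prop :=
  ∃ L : Op n, L.IsHermitian ∧ HasDerivAt ρ ((1 / 2 : ℂ) • (L * ρ ω + ρ ω * L)) ω ∧
    (F : ℂ) = (ρ ω * (L * L)).trace

/-- The values of the quantum Fisher information about `ω`, after probing time `t`, obtained from
the initial states in the code. -/
def codeQFIs {ι : Type} (g : ι → Op n) (ω t : ℝ) : Set ℝ :=
  {F | ∃ ρ₀, IsCodeState g ρ₀ ∧ HasQFI (fun w => evolve (effGenerator g w) t ρ₀) ω F}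

/-- The quantum Fisher information achieved by the code: that of the best initial code state. -/
def codeQFI {ι : Type} (g : ι → Op n) (ω t : ℝ) : ℝ := sSup (codeQFIs g ω t)

end Dynamics

end QRM

end

open QRM

namespace QRM

/-! ### The Pauli operators -/

/-! Everything is read off from the binary vectors in X^a Z^b. Its syndrome is additive in (a, b):
X-type generators test b against the v_i, Z-type ones test a against monomials of degree at most m -
2. The columns of the matrix of the v_i are the distinct nonzero points of 𝔽₂^m, so the v_i are the
parity checks of a Hamming code. As m - 2 ≥ 1, the vector a also passes these checks when its
syndrome vanishes. Hence every Pauli operator of weight 1 or 2 has nonzero syndrome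
(`detectsTwo_qrm`).

The space dual to the shortened RM(m-2,m) consists of the affine functions on the nonzero points
(`exists_affine_of_orthogonal`). A code vector is therefore supported on two cosets of the span of
the v_i and constant on each, which gives dimension 2. Dually, an even-weight Hamming word is the Z
part of a stabilizer (`mem_rmSpan_of_orthogonal`).

A triple Z string commutes with the X checks exactly when its three points sum to zero, that is,
form a line of the projective space. Two points determine a line and a line has six ordered pairs,
so there are n(n-1)/6 lines. The complement of a line is an even-weight Hamming word, so every line
acts on the code as the logical Z, while every other triple is killed by Π on both sides. So ΠGΠ is
the logical Z on the code times the number of lines.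

The recovery R is idempotent, and rounds R exp(tL/N) converge to the flow of RLR
(`tendsto_iterate_exp`). Since errors of weight at most 2 are detected, Π makes a 2-local operator
scalar, which drops out of the commutator; the Knill–Laflamme condition makes the jump term and the
anticommutator of single-qubit noise cancel (`recovery_lindbladian`). Only the commutator with ωΠGΠ
remains.

The limiting evolution is unitary with generator K = ΠGΠ. The Fisher information is at most 4t²
Tr(ρK²) (`fisher_le`). On the code K² is the squared number of lines, so this bound is the same for
all code states; the logical |+⟩, where K has mean zero, attains it. -/

/-- The sign `(-1)^s`. -/
noncomputable def zsign (s : ZMod 2) : ℂ := if s = 0 then 1 else -1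

@[simp] lemma zsign_zero : zsign 0 = 1 := by simp [zsign]

@[simp] lemma zsign_one : zsign 1 = -1 := by simp [zsign]

lemma zmod_two_cases (s : ZMod 2) : s = 0 ∨ s = 1 := by
  revert s; decide

lemma zmod_two_add_self (s : ZMod 2) : s + s = 0 := CharTwo.add_self_eq_zero s

lemma vec_add_self {α : Type*} (a : α → ZMod 2) : a + a = 0 :=
  funext fun _ => zmod_two_add_self _

lemma zsign_add (s t : ZMod 2) : zsign (s + t) = zsign s * zsign t := by
  rcases zmod_two_cases s with rfl | rfl <;> rcases zmod_two_cases t with rfl | rfl <;>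
    simp [zmod_two_add_self]

lemma zsign_mul_self (s : ZMod 2) : zsign s * zsign s = 1 := by
  rw [← zsign_add, zmod_two_add_self, zsign_zero]

lemma zsign_ne_zero (s : ZMod 2) : zsign s ≠ 0 := by
  rcases zmod_two_cases s with rfl | rfl <;> simp

lemma zsign_injective : Function.Injective zsign := by
  intro s t h
  rcases zmod_two_cases s with rfl | rfl <;> rcases zmod_two_cases t with rfl | rfl <;>
    simp at h ⊢
  · norm_num [eq_comm] at h
  · exact absurd h (by norm_num [Complex.ext_iff])

@[simp] lemma star_zsign (s : ZMod 2) : star (zsign s) = zsign s := by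
  rcases zmod_two_cases s with rfl | rfl <;> simp

lemma zsign_sum {α : Type*} (s : Finset α) (f : α → ZMod 2) :
    zsign (∑ i ∈ s, f i) = ∏ i ∈ s, zsign (f i) := by
  classical
  induction s using Finset.induction_on with
  | empty => simp
  | insert a s ha ih => rw [Finset.sum_insert ha, Finset.prod_insert ha, zsign_add, ih]

lemma zsign_eq_I_pow (s : ZMod 2) : ∃ k : ℕ, zsign s = Complex.I ^ k := by
  rcases zmod_two_cases s with rfl | rfl
  · exact ⟨0, by simp⟩
  · exact ⟨2, by simp⟩

variable {n : ℕ}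

/-- The Pauli operator `X^a Z^b`. -/
noncomputable def pauli (a b : Fin n → ZMod 2) : Op n := pauliX a * pauliZ b

lemma pauliZ_eq (b : Fin n → ZMod 2) : pauliZ b = Matrix.diagonal fun x => zsign (b ⬝ᵥ x) := by
  unfold pauliZ
  congr 1
  funext x
  rw [dotProduct, zsign_sum]
  refine Finset.prod_congr rfl fun i _ => ?_
  rcases zmod_two_cases (b i) with h | h <;> rcases zmod_two_cases (x i) with h' | h' <;>
    simp [h, h']

@[simp] lemma pauliX_zero : pauliX (0 : Fin n → ZMod 2) = 1 := by
  ext x y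
  simp [pauliX, Matrix.one_apply]

@[simp] lemma pauliZ_zero : pauliZ (0 : Fin n → ZMod 2) = 1 := by
  simp [pauliZ_eq]

lemma pauli_apply (a b x y : Fin n → ZMod 2) :
    pauli a b x y = if x = y + a then zsign (b ⬝ᵥ y) else 0 := by
  simp [pauli, pauliZ_eq, pauliX, Matrix.mul_diagonal]

lemma pauli_zero_right (a : Fin n → ZMod 2) : pauli a 0 = pauliX a := by simp [pauli]

lemma pauli_zero_left (b : Fin n → ZMod 2) : pauli 0 b = pauliZ b := by simp [pauli]

@[simp] lemma pauli_zero : pauli (0 : Fin n → ZMod 2) 0 = 1 := by simp [pauli]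

lemma pauliX_mul (a a' : Fin n → ZMod 2) : pauliX a * pauliX a' = pauliX (a + a') := by
  ext x y
  simp only [pauliX, Matrix.mul_apply, Matrix.of_apply]
  simp [add_assoc, add_comm a a']

lemma pauliZ_mul (b b' : Fin n → ZMod 2) : pauliZ b * pauliZ b' = pauliZ (b + b') := by
  simp [pauliZ_eq, add_dotProduct, zsign_add]

lemma pauliZ_mul_pauliX (a b : Fin n → ZMod 2) :
    pauliZ b * pauliX a = zsign (b ⬝ᵥ a) • pauli a b := by
  ext x y
  rw [Matrix.smul_apply, pauli_apply, pauliZ_eq, Matrix.diagonal_mul, pauliX, Matrix.of_apply]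
  split_ifs with h
  · subst h
    simp [dotProduct_add, zsign_add, mul_comm]
  · simp

lemma pauli_mul (a b a' b' : Fin n → ZMod 2) :
    pauli a b * pauli a' b' = zsign (b ⬝ᵥ a') • pauli (a + a') (b + b') := by
  calc pauli a b * pauli a' b' = pauliX a * (pauliZ b * pauliX a') * pauliZ b' := by
        simp [pauli, mul_assoc]
    _ = _ := by
        rw [pauliZ_mul_pauliX, pauli, mul_smul_comm, smul_mul_assoc, pauli, ← mul_assoc,
          pauliX_mul, mul_assoc, pauliZ_mul]

lemma pauliX_conjTranspose (a : Fin n → ZMod 2) : (pauliX a)ᴴ = pauliX a := by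
  ext x y
  simp only [pauliX, Matrix.conjTranspose_apply, Matrix.of_apply]
  have : y = x + a ↔ x = y + a := by
    constructor <;> rintro rfl <;> rw [add_assoc, vec_add_self, add_zero]
  simp [this, apply_ite]

lemma pauliZ_conjTranspose (b : Fin n → ZMod 2) : (pauliZ b)ᴴ = pauliZ b := by
  rw [pauliZ_eq, Matrix.diagonal_conjTranspose]
  congr 1
  funext x
  simp

lemma pauli_conjTranspose (a b : Fin n → ZMod 2) : (pauli a b)ᴴ = pauliZ b * pauliX a := by
  rw [pauli, Matrix.conjTranspose_mul, pauliX_conjTranspose, pauliZ_conjTranspose]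

lemma pauli_conjTranspose_mul_self (a b : Fin n → ZMod 2) : (pauli a b)ᴴ * pauli a b = 1 := by
  rw [pauli_conjTranspose, pauli, mul_assoc, ← mul_assoc (pauliX a), pauliX_mul, vec_add_self,
    pauliX_zero, one_mul, pauliZ_mul, vec_add_self, pauliZ_zero]

/-- `X^a Z^b` and `X^a' Z^b'` commute up to the sign given by the symplectic form. -/
lemma pauli_mul_comm (a b a' b' : Fin n → ZMod 2) :
    pauli a b * pauli a' b' = zsign (b ⬝ᵥ a' + b' ⬝ᵥ a) • (pauli a' b' * pauli a b) := by
  rw [pauli_mul, pauli_mul, smul_smul, zsign_add, mul_assoc, zsign_mul_self, mul_one,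
    add_comm a, add_comm b]

/-- Column 0 has its only nonzero entry in row a, with value c; the columns at unit vectors then
reveal the entries of b. -/
lemma smul_pauli_inj {c c' : ℂ} {a b a' b' : Fin n → ZMod 2} (hc : c ≠ 0)
    (h : c • pauli a b = c' • pauli a' b') : a = a' ∧ b = b' ∧ c = c' := by
  have key : ∀ x y, (c * if x = y + a then zsign (b ⬝ᵥ y) else 0) =
      c' * if x = y + a' then zsign (b' ⬝ᵥ y) else 0 := fun x y => by
    have := congrFun (congrFun h x) y
    simpa only [Matrix.smul_apply, pauli_apply, smul_eq_mul] using this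
  have ha : a = a' := by
    by_contra hne
    have := key a 0
    simp [hne, hc] at this
  subst ha
  have hcc : c = c' := by simpa using key a 0
  subst hcc
  refine ⟨rfl, funext fun i => ?_, rfl⟩
  have := key (Pi.single i 1 + a) (Pi.single i 1)
  simp only [if_true, mul_right_inj' hc] at this
  simpa using zsign_injective this

lemma pauli_inj {a b a' b' : Fin n → ZMod 2} (h : pauli a b = pauli a' b') : a = a' ∧ b = b' := by
  have := smul_pauli_inj (c := 1) (c' := 1) one_ne_zero (by simpa using h)
  exact ⟨this.1, this.2.1⟩

lemma I_pow_ne_zero (k : ℕ) : Complex.I ^ k ≠ 0 := pow_ne_zero _ Complex.I_ne_zero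

lemma isPauli_pauli (a b : Fin n → ZMod 2) : IsPauli (pauli a b) :=
  ⟨_, 0, a, b, rfl, by simp [pauli]⟩

lemma isPauli_pauli_conjTranspose (a b : Fin n → ZMod 2) : IsPauli (pauli a b)ᴴ := by
  obtain ⟨k, hk⟩ := zsign_eq_I_pow (b ⬝ᵥ a)
  exact ⟨_, k, a, b, rfl, by rw [pauli_conjTranspose, pauliZ_mul_pauliX, hk]; rfl⟩

@[simp] lemma weight_zero : weight (0 : Fin n → ZMod 2) 0 = 0 := by simp [weight]

lemma weight_add_le (a b a' b' : Fin n → ZMod 2) :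
    weight (a + a') (b + b') ≤ weight a b + weight a' b' := by
  unfold weight
  refine le_trans (Finset.card_le_card ?_) (Finset.card_union_le _ _)
  intro i
  simp only [Finset.mem_filter, Finset.mem_univ, true_and, Finset.mem_union, Pi.add_apply]
  intro h
  by_contra! h'
  rcases h with h | h <;> simp [h'.1.1, h'.1.2, h'.2.1, h'.2.2] at h

lemma weight_le_of_support {s : Finset (Fin n)} {a b : Fin n → ZMod 2}
    (h : ∀ i ∉ s, a i = 0 ∧ b i = 0) : weight a b ≤ s.card := by
  refine Finset.card_le_card fun i => ?_
  simp only [Finset.mem_filter, Finset.mem_univ, true_and]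
  intro h'
  by_contra hi
  rcases h' with h' | h'
  · exact h' (h i hi).1
  · exact h' (h i hi).2

/-- The diagonal matrix units are combinations of the `Z^b`. -/
lemma sum_zsign_smul_pauliZ (y : Fin n → ZMod 2) :
    ∑ b : Fin n → ZMod 2, zsign (b ⬝ᵥ y) • pauliZ b = (2 : ℂ) ^ n • Matrix.single y y 1 := by
  -- Orthogonality of characters: the sum over b factors into one two-term sum per qubit, which
  -- vanishes wherever x and y differ.
  have hpoly : ∀ x : Fin n → ZMod 2, ∑ b : Fin n → ZMod 2, zsign (b ⬝ᵥ y) * zsign (b ⬝ᵥ x) =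
      if x = y then 2 ^ n else 0 := by
    intro x
    have h1 : ∀ b : Fin n → ZMod 2, zsign (b ⬝ᵥ y) * zsign (b ⬝ᵥ x) =
        ∏ i, zsign (b i * (y i + x i)) := by
      intro b
      rw [← zsign_add, ← dotProduct_add, dotProduct, zsign_sum]
      rfl
    simp_rw [h1]
    have h2 := Finset.prod_univ_sum (fun _ : Fin n => (Finset.univ : Finset (ZMod 2)))
      (fun i t => zsign (t * (y i + x i)))
    rw [Fintype.piFinset_univ] at h2
    rw [← h2]
    have h3 : ∀ s : ZMod 2, ∑ t : ZMod 2, zsign (t * s) = if s = 0 then 2 else 0 := by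
      intro s
      have : ∀ f : ZMod 2 → ℂ, ∑ t, f t = f 0 + f 1 := fun f => Fin.sum_univ_two f
      rw [this]
      rcases zmod_two_cases s with rfl | rfl <;> norm_num
    simp_rw [h3]
    split_ifs with hxy
    · subst hxy
      simp [zmod_two_add_self]
    · obtain ⟨i, hi⟩ := Function.ne_iff.mp hxy
      refine Finset.prod_eq_zero (Finset.mem_univ i) (if_neg fun h => hi ?_)
      exact (CharTwo.add_eq_zero.mp h).symm
  ext x z
  simp only [pauliZ_eq, Matrix.sum_apply, Matrix.smul_apply, smul_eq_mul]
  by_cases hxz : x = z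
  · subst hxz
    simp only [Matrix.diagonal_apply_eq, hpoly]
    by_cases hxy : x = y
    · subst hxy; simp
    · rw [if_neg hxy, Matrix.single_apply_of_ne (h := by simp [Ne.symm hxy])]; simp
  · simp only [Matrix.diagonal_apply_ne _ hxz, mul_zero, Finset.sum_const_zero]
    rw [Matrix.single_apply_of_ne (h := by rintro ⟨rfl, rfl⟩; exact hxz rfl)]
    simp

/-- The Pauli operators span all operators. -/
lemma mem_span_pauli (M : Op n) :
    M ∈ Submodule.span ℂ (Set.range fun p : (Fin n → ZMod 2) × (Fin n → ZMod 2) =>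
      pauli p.1 p.2) := by
  rw [Matrix.matrix_eq_sum_single M]
  refine Submodule.sum_mem _ fun x _ => Submodule.sum_mem _ fun y _ => ?_
  -- The matrix unit |x⟩⟨y| is X^(x+y) |y⟩⟨y|, and |y⟩⟨y| is an average of signed Z strings.
  have h : Matrix.single x y (M x y) = (M x y * ((2 : ℂ) ^ n)⁻¹) •
      ∑ b : Fin n → ZMod 2, zsign (b ⬝ᵥ y) • pauli (x + y) b := by
    simp_rw [pauli, ← mul_smul_comm, ← Finset.mul_sum]
    rw [sum_zsign_smul_pauliZ, mul_smul_comm, smul_smul, mul_assoc,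
      inv_mul_cancel₀ (by positivity), mul_one]
    ext u v
    rw [Matrix.smul_apply]
    by_cases hv : v = y
    · subst hv
      rw [Matrix.mul_single_apply_same]
      simp only [pauliX, Matrix.of_apply]
      by_cases hu : u = x
      · subst hu
        simp [add_comm v, add_assoc, vec_add_self]
      · rw [Matrix.single_apply_of_ne (h := by rintro ⟨rfl, -⟩; exact hu rfl), if_neg]
        · simp
        · rwa [add_comm x, ← add_assoc, vec_add_self, zero_add]
    · rw [Matrix.mul_single_apply_of_ne (hbj := hv),
        Matrix.single_apply_of_ne (h := by rintro ⟨-, rfl⟩; exact hv rfl), smul_zero]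
  rw [h]
  exact Submodule.smul_mem _ _ (Submodule.sum_mem _ fun b _ => Submodule.smul_mem _ _
    (Submodule.subset_span ⟨(x + y, b), rfl⟩))

/-! ### Syndrome projections -/

section Syndrome

variable {n : ℕ} {ι : Type} {g : ι → Op n}

lemma toEuclideanLin_mul (A B : Op n) :
    Matrix.toEuclideanLin (A * B) = Matrix.toEuclideanLin A ∘ₗ Matrix.toEuclideanLin B :=
  Matrix.toLpLin_mul_same 2 A B

lemma toEuclideanLin_syndromeProj (g : ι → Op n) (s : ι → ZMod 2) :
    Matrix.toEuclideanLin (syndromeProj g s) =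
      (syndromeSpace g s).starProjection.toLinearMap := by
  simp [syndromeProj]

lemma mem_syndromeSpace_iff {s : ι → ZMod 2} {v : EuclideanSpace ℂ (Fin n → ZMod 2)} :
    v ∈ syndromeSpace g s ↔ ∀ j, Matrix.toEuclideanLin (g j) v = zsign (s j) • v := by
  simp only [syndromeSpace, Submodule.mem_iInf, Module.End.mem_eigenspace_iff]
  rfl

lemma gen_mul_syndromeProj (s : ι → ZMod 2) (j : ι) :
    g j * syndromeProj g s = zsign (s j) • syndromeProj g s := by
  apply Matrix.toEuclideanLin.injective
  rw [toEuclideanLin_mul, map_smul, toEuclideanLin_syndromeProj]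
  refine LinearMap.ext fun v => ?_
  exact mem_syndromeSpace_iff.mp ((syndromeSpace g s).starProjection_apply_mem v) j

/-- The range of M lies in the syndrome space, where the projection is the identity. -/
lemma syndromeProj_mul_of_forall {s : ι → ZMod 2} {M : Op n}
    (h : ∀ j, g j * M = zsign (s j) • M) : syndromeProj g s * M = M := by
  apply Matrix.toEuclideanLin.injective
  rw [toEuclideanLin_mul, toEuclideanLin_syndromeProj]
  refine LinearMap.ext fun v => ?_
  refine Submodule.starProjection_eq_self_iff.mpr (mem_syndromeSpace_iff.mpr fun j => ?_)
  have := congrArg Matrix.toEuclideanLin (h j)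
  rw [toEuclideanLin_mul, map_smul] at this
  exact LinearMap.congr_fun this v

lemma syndromeProj_mul_self (s : ι → ZMod 2) :
    syndromeProj g s * syndromeProj g s = syndromeProj g s :=
  syndromeProj_mul_of_forall fun j => gen_mul_syndromeProj s j

lemma syndromeProj_conjTranspose (s : ι → ZMod 2) :
    (syndromeProj g s)ᴴ = syndromeProj g s := by
  apply Matrix.toEuclideanLin.injective
  rw [Matrix.toEuclideanLin_conjTranspose_eq_adjoint, toEuclideanLin_syndromeProj, eq_comm,
    LinearMap.eq_adjoint_iff]
  intro x y
  exact (syndromeSpace g s).inner_starProjection_left_eq_right x y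

lemma syndromeProj_mul_gen (hg : ∀ j, (g j)ᴴ = g j) (s : ι → ZMod 2) (j : ι) :
    syndromeProj g s * g j = zsign (s j) • syndromeProj g s := by
  have := congrArg Matrix.conjTranspose (gen_mul_syndromeProj (g := g) s j)
  rwa [Matrix.conjTranspose_mul, Matrix.conjTranspose_smul, syndromeProj_conjTranspose, hg,
    star_zsign] at this

/-- Eigenspaces of a Hermitian generator for the eigenvalues 1 and -1 are orthogonal; one generator
on which the syndromes differ suffices. -/
lemma syndromeProj_mul_of_ne (hg : ∀ j, (g j)ᴴ = g j) {s s' : ι → ZMod 2} (hs : s ≠ s') {M : Op n}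
    (h : ∀ j, g j * M = zsign (s' j) • M) : syndromeProj g s * M = 0 := by
  obtain ⟨j, hj⟩ := Function.ne_iff.mp hs
  have h1 : syndromeProj g s * (g j * M) = zsign (s j) • (syndromeProj g s * M) := by
    rw [← mul_assoc, syndromeProj_mul_gen hg, smul_mul_assoc]
  rw [h j, mul_smul_comm, ← sub_eq_zero, ← sub_smul, smul_eq_zero] at h1
  exact h1.resolve_left fun h2 => hj (zsign_injective (sub_eq_zero.mp h2).symm)

lemma trace_syndromeProj (s : ι → ZMod 2) :
    (syndromeProj g s).trace = Module.finrank ℂ (syndromeSpace g s) := by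
  have hp : LinearMap.IsProj (syndromeSpace g s)
      (Matrix.toEuclideanLin (syndromeProj g s)) := by
    rw [toEuclideanLin_syndromeProj]
    exact ⟨fun v => (syndromeSpace g s).starProjection_apply_mem v,
      fun v hv => Submodule.starProjection_eq_self_iff.mpr hv⟩
  rw [← hp.trace, Matrix.toEuclideanLin, Matrix.toLpLin_eq_toLin, Matrix.trace_toLin_eq]

lemma gen_mul_codeProj (j : ι) : g j * codeProj g = codeProj g := by
  have := gen_mul_syndromeProj (g := g) 0 j
  rwa [Pi.zero_apply, zsign_zero, one_smul] at this

lemma codeProj_mul_self : codeProj g * codeProj g = codeProj g := syndromeProj_mul_self 0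

lemma codeProj_conjTranspose : (codeProj g)ᴴ = codeProj g := syndromeProj_conjTranspose 0

lemma codeProj_mul_of_forall {M : Op n} (h : ∀ j, g j * M = M) : codeProj g * M = M :=
  syndromeProj_mul_of_forall (s := 0) fun j => by simpa using h j

lemma stabilizer_mul_codeProj {Q : Op n} (hQ : Q ∈ stabilizer g) :
    Q * codeProj g = codeProj g := by
  induction hQ using Submonoid.closure_induction with
  | mem x hx => obtain ⟨j, rfl⟩ := hx; exact gen_mul_codeProj j
  | one => exact one_mul _
  | mul x y _ _ hx hy => rw [mul_assoc, hy, hx]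

/-- Stabilizers fix the code space, and -1 fixes only the zero vector. -/
lemma neg_one_notMem_stabilizer (h : codeProj g ≠ 0) : (-1 : Op n) ∉ stabilizer g := by
  intro h'
  have := stabilizer_mul_codeProj h'
  rw [neg_one_mul] at this
  have h2 : (2 : ℂ) • codeProj g = 0 := by
    rw [two_smul]
    nth_rewrite 1 [← this]
    exact neg_add_cancel _
  exact h ((smul_eq_zero.mp h2).resolve_left two_ne_zero)

/-- The syndromes of the Pauli operators with respect to Hermitian generators `g`: the generator
`g j` commutes with `X^a Z^b` up to the sign `(-1)^(σ (a, b) j)`. -/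
structure IsSyndrome (g : ι → Op n)
    (σ : (Fin n → ZMod 2) × (Fin n → ZMod 2) →+ (ι → ZMod 2)) : Prop where
  herm : ∀ j, (g j)ᴴ = g j
  comm : ∀ j a b, g j * pauli a b = zsign (σ (a, b) j) • (pauli a b * g j)

variable {σ : (Fin n → ZMod 2) × (Fin n → ZMod 2) →+ (ι → ZMod 2)}

/-- Moving the generator past the Pauli operator costs its commutation sign, so Pauli operators
translate the syndrome sectors. -/
lemma IsSyndrome.gen_mul_pauli_mul (h : IsSyndrome g σ) (j : ι) (a b : Fin n → ZMod 2)
    {s : ι → ZMod 2} {M : Op n} (hM : ∀ j, g j * M = zsign (s j) • M) :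
    g j * (pauli a b * M) = zsign ((s + σ (a, b)) j) • (pauli a b * M) := by
  rw [← mul_assoc, h.comm, smul_mul_assoc, mul_assoc, hM, mul_smul_comm, smul_smul, Pi.add_apply,
    zsign_add, mul_comm]

lemma IsSyndrome.gen_mul_pauli_mul_codeProj (h : IsSyndrome g σ) (j : ι) (a b : Fin n → ZMod 2) :
    g j * (pauli a b * codeProj g) = zsign (σ (a, b) j) • (pauli a b * codeProj g) := by
  have := h.gen_mul_pauli_mul j a b (s := 0) (M := codeProj g)
    (fun j => by simpa using gen_mul_codeProj j)
  simpa using this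

lemma IsSyndrome.syndromeProj_mul_pauli_mul_codeProj (h : IsSyndrome g σ) (s : ι → ZMod 2)
    (a b : Fin n → ZMod 2) [Decidable (s = σ (a, b))] :
    syndromeProj g s * (pauli a b * codeProj g) =
      if s = σ (a, b) then pauli a b * codeProj g else 0 := by
  split_ifs with hs
  · subst hs
    exact syndromeProj_mul_of_forall fun j => h.gen_mul_pauli_mul_codeProj j a b
  · exact syndromeProj_mul_of_ne h.herm hs fun j => h.gen_mul_pauli_mul_codeProj j a b

lemma IsSyndrome.codeProj_mul_pauli_mul_codeProj (h : IsSyndrome g σ) {a b : Fin n → ZMod 2}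
    (hab : σ (a, b) ≠ 0) : codeProj g * pauli a b * codeProj g = 0 := by
  classical
  have := h.syndromeProj_mul_pauli_mul_codeProj 0 a b
  rwa [if_neg hab.symm, ← mul_assoc] at this

/-- A syndrome with a nonzero eigenspace is the syndrome of some Pauli operator. -/
lemma IsSyndrome.exists_pauli (h : IsSyndrome g σ) (hP : codeProj g ≠ 0) {s : ι → ZMod 2}
    (hs : syndromeProj g s ≠ 0) : ∃ p, σ p = s := by
  classical
  by_contra! hno
  -- No Pauli operator maps the code into sector s, and Pauli operators span all matrices, so no
  -- operator at all does.
  have hzero : ∀ M : Op n, syndromeProj g s * (M * codeProj g) = 0 := by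
    intro M
    induction mem_span_pauli M using Submodule.span_induction with
    | mem x hx =>
      obtain ⟨p, rfl⟩ := hx
      rw [h.syndromeProj_mul_pauli_mul_codeProj, if_neg fun hp => hno _ hp.symm]
    | zero => simp
    | add x y _ _ hx hy => rw [add_mul, mul_add, hx, hy, add_zero]
    | smul c x _ hx => rw [smul_mul_assoc, mul_smul_comm, hx, smul_zero]
  obtain ⟨x, y, hxy⟩ : ∃ x y, codeProj g x y ≠ 0 := by
    by_contra! h0
    exact hP (Matrix.ext h0)
  refine hs (Matrix.ext fun u v => ?_)
  -- For this matrix unit the (u, y) entry is the (u, v) entry of the sector projection times the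
  -- nonzero (x, y) entry of Π.
  have := congrFun (congrFun (hzero (Matrix.single v x 1)) u) y
  rw [← mul_assoc, Matrix.mul_apply, Finset.sum_eq_single x] at this
  · rw [Matrix.mul_single_apply_same, mul_one] at this
    exact (mul_eq_zero.mp this).resolve_right hxy
  · intro z _ hz
    rw [Matrix.mul_single_apply_of_ne (hbj := hz), zero_mul]
  · simp

end Syndrome

/-! ### Product formulas for the exponential in a Banach algebra -/

section Zeno

open Filter

/-- Telescoping of the difference of powers, with every remaining factor bounded by r. -/
lemma norm_pow_sub_pow_le {A : Type*} [NormedRing A] [NormOneClass A] {x y : A} {r : ℝ}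
    (hx : ‖x‖ ≤ r) (hy : ‖y‖ ≤ r) (hr : 1 ≤ r) (k : ℕ) :
    ‖x ^ k - y ^ k‖ ≤ k * r ^ k * ‖x - y‖ := by
  induction k with
  | zero => simp
  | succ k ih =>
    have h1 : x ^ (k + 1) - y ^ (k + 1) = x ^ k * (x - y) + (x ^ k - y ^ k) * y := by
      rw [pow_succ, pow_succ]; noncomm_ring
    have h2 : ‖x ^ k‖ ≤ r ^ k := (norm_pow_le x k).trans (pow_le_pow_left₀ (norm_nonneg _) hx k)
    have hd := norm_nonneg (x - y)
    have hrk : r ^ k ≤ r ^ (k + 1) := pow_le_pow_right₀ hr k.le_succ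
    calc ‖x ^ (k + 1) - y ^ (k + 1)‖ ≤ ‖x ^ k‖ * ‖x - y‖ + ‖x ^ k - y ^ k‖ * ‖y‖ := by
          rw [h1]
          exact (norm_add_le _ _).trans (add_le_add (norm_mul_le _ _) (norm_mul_le _ _))
      _ ≤ r ^ (k + 1) * ‖x - y‖ + (k * r ^ k * ‖x - y‖) * r := by
          gcongr
          exact h2.trans hrk
      _ = _ := by push_cast; ring

/-- These are the difference quotients at 0 of s ↦ exp (s c), taken at s = 1/N. -/
lemma tendsto_smul_exp_sub_one {A : Type*} [NormedRing A] [NormedAlgebra ℝ A] [CompleteSpace A]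
    (c : A) : Tendsto (fun N : ℕ => (N : ℝ) • (NormedSpace.exp ((N : ℝ)⁻¹ • c) - 1)) atTop
      (𝓝 c) := by
  have h := (hasDerivAt_exp_smul_const (𝕂 := ℝ) c 0).tendsto_slope_zero
  have h2 : Tendsto (fun N : ℕ => (N : ℝ)⁻¹) atTop (𝓝[≠] 0) := by
    refine tendsto_nhdsWithin_iff.mpr ⟨tendsto_inv_atTop_nhds_zero_nat, ?_⟩
    filter_upwards [eventually_gt_atTop 0] with N hN
    simpa using hN.ne'
  simpa [Function.comp_def] using h.comp h2

/-- If `N a_N → c` then `(1 + a_N)^N → exp c`. -/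
lemma tendsto_one_add_pow_exp {A : Type*} [NormedRing A] [NormOneClass A] [NormedAlgebra ℝ A]
    [CompleteSpace A] {a : ℕ → A} {c : A}
    (h : Tendsto (fun N : ℕ => (N : ℝ) • a N) atTop (𝓝 c)) :
    Tendsto (fun N => (1 + a N) ^ N) atTop (𝓝 (NormedSpace.exp c)) := by
  let _ : NormedAlgebra ℚ A := NormedAlgebra.restrictScalars ℚ ℝ A
  -- Comparison sequence for which (1 + b_N)^N is exactly exp c once N > 0; it remains to bound the
  -- difference of two N-th powers.
  set b : ℕ → A := fun N => NormedSpace.exp ((N : ℝ)⁻¹ • c) - 1 with hb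
  have hbc : Tendsto (fun N : ℕ => (N : ℝ) • b N) atTop (𝓝 c) := tendsto_smul_exp_sub_one c
  have hexp : ∀ᶠ N : ℕ in atTop, (1 + b N) ^ N = NormedSpace.exp c := by
    filter_upwards [eventually_gt_atTop 0] with N hN
    rw [hb, add_sub_cancel, ← NormedSpace.exp_nsmul, ← Nat.cast_smul_eq_nsmul ℝ, smul_smul,
      mul_inv_cancel₀ (by positivity), one_smul]
  have hbound : ∀ {d : ℕ → A}, Tendsto (fun N : ℕ => (N : ℝ) • d N) atTop (𝓝 c) →
      ∀ᶠ N : ℕ in atTop, ‖1 + d N‖ ≤ 1 + (‖c‖ + 1) / N := by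
    intro d hd
    filter_upwards [hd.norm.eventually_le_const (lt_add_one ‖c‖), eventually_gt_atTop 0]
      with N hN hN0
    have hN0' : (0 : ℝ) < N := Nat.cast_pos.mpr hN0
    refine (norm_add_le _ _).trans (add_le_add norm_one.le ?_)
    rw [norm_smul, Real.norm_natCast] at hN
    rwa [le_div_iff₀ hN0', mul_comm]
  have hdiff : Tendsto (fun N : ℕ => Real.exp (‖c‖ + 1) * ‖(N : ℝ) • (a N - b N)‖) atTop
      (𝓝 0) := by
    have := ((h.sub hbc).norm).const_mul (Real.exp (‖c‖ + 1))
    simpa [smul_sub] using this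
  have hzero : Tendsto (fun N => (1 + a N) ^ N - (1 + b N) ^ N) atTop (𝓝 0) := by
    refine squeeze_zero_norm' ?_ hdiff
    filter_upwards [hbound h, hbound hbc, eventually_gt_atTop 0] with N h1 h2 hN
    have hN' : (0 : ℝ) < N := Nat.cast_pos.mpr hN
    refine (norm_pow_sub_pow_le h1 h2 (le_add_of_nonneg_right (by positivity)) N).trans ?_
    rw [norm_smul, Real.norm_natCast, add_sub_add_left_eq_sub]
    have h3 : (1 + (‖c‖ + 1) / N) ^ N ≤ Real.exp (‖c‖ + 1) := by
      refine (pow_le_pow_left₀ (by positivity)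
        ((add_comm _ _).le.trans (Real.add_one_le_exp ((‖c‖ + 1) / N))) N).trans ?_
      rw [← Real.exp_nat_mul, mul_div_cancel₀ _ hN'.ne']
    calc (N : ℝ) * (1 + (‖c‖ + 1) / N) ^ N * ‖a N - b N‖
        ≤ N * Real.exp (‖c‖ + 1) * ‖a N - b N‖ := by gcongr
      _ = _ := by ring
  have := hzero.add (tendsto_const_nhds (x := NormedSpace.exp c))
  rw [zero_add] at this
  refine this.congr' ?_
  filter_upwards [hexp] with N hN
  rw [hN, sub_add_cancel]

/-- Interrupting the flow `exp (s L)` with the idempotent `R` leads to the flow generated by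
`R L R`. -/
lemma tendsto_iterate_exp {E : Type*} [NormedAddCommGroup E] [NormedSpace ℂ E] [CompleteSpace E]
    [Nontrivial E] {R L K : E →L[ℂ] E} (hR : R * R = R) (hK : K * R = R * L * R) (t : ℝ) {v : E}
    (hv : R v = v) :
    Tendsto (fun N : ℕ => (fun x => R (NormedSpace.exp ((t / N) • L) x))^[N] v) atTop
      (𝓝 (NormedSpace.exp (t • K) v)) := by
  let _ : NormedAlgebra ℚ (E →L[ℂ] E) := NormedAlgebra.restrictScalars ℚ ℂ _
  set K' := R * L * R with hK'
  have hRK' : R * K' = K' := by rw [hK', ← mul_assoc, ← mul_assoc, hR]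
  have hK'R : K' * R = K' := by rw [hK', mul_assoc, hR]
  -- K agrees with R L R only on the range of R. Since R intertwines R L R with both generators, it
  -- intertwines it with both exponentials, which therefore agree on v.
  have hexp : NormedSpace.exp (t • K) v = NormedSpace.exp (t • K') v := by
    have h1 : SemiconjBy R (t • K') (t • K) := by
      rw [SemiconjBy, mul_smul_comm, smul_mul_assoc, hRK', hK]
    have h2 : SemiconjBy R (t • K') (t • K') := by
      rw [SemiconjBy, mul_smul_comm, smul_mul_assoc, hRK', hK'R]
    have h3 : NormedSpace.exp (t • K) * R = NormedSpace.exp (t • K') * R :=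
      h1.exp_right.eq.symm.trans h2.exp_right.eq
    have := congrArg (fun T : E →L[ℂ] E => T v) h3
    simpa [hv] using this
  -- On vectors fixed by R, one round acts as 1 + a_N. Compressing only exp - 1 keeps the factor
  -- near the identity, as the product formula needs.
  set a : ℕ → E →L[ℂ] E := fun N => R * (NormedSpace.exp ((N : ℝ)⁻¹ • (t • L)) - 1) * R with ha
  have hlim : Tendsto (fun N => (1 + a N) ^ N) atTop (𝓝 (NormedSpace.exp (t • K'))) := by
    refine tendsto_one_add_pow_exp ?_
    have h := ((tendsto_smul_exp_sub_one (t • L)).const_mul R).mul_const R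
    rw [mul_smul_comm, smul_mul_assoc] at h
    refine h.congr fun N => ?_
    rw [ha, mul_smul_comm, smul_mul_assoc]
  -- Invariance under R is carried through the induction because the rewriting of a round as 1 + a_N
  -- needs it.
  have hiter : ∀ N k : ℕ, R (((1 + a N) ^ k) v) = ((1 + a N) ^ k) v ∧
      (fun x => R (NormedSpace.exp ((t / N) • L) x))^[k] v = ((1 + a N) ^ k) v := by
    intro N k
    induction k with
    | zero => exact ⟨hv, rfl⟩
    | succ k ih =>
      have hstep : ((1 + a N) ^ (k + 1)) v =
          R (NormedSpace.exp ((t / N) • L) (((1 + a N) ^ k) v)) := by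
        rw [pow_succ', mul_apply_eq_comp]
        generalize ((1 + a N) ^ k) v = w at ih
        simp only [ha, add_apply, one_apply_eq_self,
          mul_apply_eq_comp, sub_apply, ih.1, map_sub, smul_smul]
        rw [add_sub_cancel, inv_mul_eq_div]
      constructor
      · rw [hstep, ← mul_apply_eq_comp R R, hR]
      · rw [Function.iterate_succ_apply', ih.2, hstep]
  rw [hexp]
  have := (ContinuousLinearMap.apply ℂ E v).continuous.tendsto _ |>.comp hlim
  refine this.congr fun N => ?_
  exact (hiter N N).2.symm

end Zeno

/-! ### Error correction -/

section Recovery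

variable {n : ℕ}

lemma sandwich_apply (A B ρ : Op n) : sandwich A B ρ = A * ρ * B := by
  simp [sandwich, mul_assoc]

lemma lindbladian_apply (H : Op n) {q : ℕ} (L : Fin q → Op n) (ρ : Op n) :
    lindbladian H L ρ = (-Complex.I) • (H * ρ - ρ * H) +
      ∑ a, (L a * ρ * (L a)ᴴ -
        (1 / 2 : ℂ) • ((L a)ᴴ * L a * ρ + ρ * ((L a)ᴴ * L a))) := by
  simp [lindbladian, sandwich_apply, mul_assoc]

lemma lindbladian_elim0_apply (H ρ : Op n) :
    lindbladian H (q := 0) Fin.elim0 ρ = (-Complex.I) • (H * ρ - ρ * H) := by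
  simp [lindbladian_apply]

variable {ι : Type} {g : ι → Op n} {σ : (Fin n → ZMod 2) × (Fin n → ZMod 2) →+ (ι → ZMod 2)}

/-- A Pauli operator with syndrome `s`, of weight at most one if possible. -/
noncomputable def likelyError (σ : (Fin n → ZMod 2) × (Fin n → ZMod 2) →+ (ι → ZMod 2))
    (s : ι → ZMod 2) : (Fin n → ZMod 2) × (Fin n → ZMod 2) :=
  open Classical in
  if h : ∃ p, weight p.1 p.2 ≤ 1 ∧ σ p = s then h.choose
  else if h : ∃ p, σ p = s then h.choose else 0

/-- The Pauli correction of the syndrome `s`. -/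
noncomputable def correction (σ : (Fin n → ZMod 2) × (Fin n → ZMod 2) →+ (ι → ZMod 2))
    (s : ι → ZMod 2) : Op n :=
  (pauli (likelyError σ s).1 (likelyError σ s).2)ᴴ

/-- The errors of weight at most `2` have nonzero syndrome. -/
def DetectsTwo (σ : (Fin n → ZMod 2) × (Fin n → ZMod 2) →+ (ι → ZMod 2)) : Prop :=
  ∀ a b, weight a b ≤ 2 → σ (a, b) = 0 → a = 0 ∧ b = 0

lemma map_likelyError {s : ι → ZMod 2} (h : ∃ p, σ p = s) : σ (likelyError σ s) = s := by
  unfold likelyError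
  split_ifs with h1
  · exact h1.choose_spec.2
  · exact h.choose_spec

/-- The product of the two errors has weight at most 2 and zero syndrome, so up to phase it is the
identity. -/
lemma DetectsTwo.eq_of_map_eq (hd : DetectsTwo σ) {p q : (Fin n → ZMod 2) × (Fin n → ZMod 2)}
    (hp : weight p.1 p.2 ≤ 1) (hq : weight q.1 q.2 ≤ 1) (h : σ p = σ q) : p = q := by
  have h0 : σ (p.1 + q.1, p.2 + q.2) = 0 := by
    rw [← Prod.mk_add_mk, Prod.mk.eta, Prod.mk.eta, map_add, h, vec_add_self]
  obtain ⟨h1, h2⟩ := hd _ _ ((weight_add_le _ _ _ _).trans (by omega)) h0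
  have key : ∀ a b : Fin n → ZMod 2, a + b = 0 → a = b := fun a b hab => by
    rw [← add_zero a, ← vec_add_self b, ← add_assoc, hab, zero_add]
  exact Prod.ext (key _ _ h1) (key _ _ h2)

lemma DetectsTwo.likelyError_map (hd : DetectsTwo σ) {p : (Fin n → ZMod 2) × (Fin n → ZMod 2)}
    (hp : weight p.1 p.2 ≤ 1) : likelyError σ (σ p) = p := by
  have h : ∃ q, weight q.1 q.2 ≤ 1 ∧ σ q = σ p := ⟨p, hp, rfl⟩
  unfold likelyError
  rw [dif_pos h]
  exact hd.eq_of_map_eq h.choose_spec.1 hp h.choose_spec.2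

lemma DetectsTwo.correction_zero (hd : DetectsTwo σ) : correction σ 0 = 1 := by
  have := hd.likelyError_map (p := 0) (by simp)
  rw [map_zero] at this
  simp [correction, this]

lemma DetectsTwo.correction_mul_pauli (hd : DetectsTwo σ)
    {p : (Fin n → ZMod 2) × (Fin n → ZMod 2)} (hp : weight p.1 p.2 ≤ 1) :
    correction σ (σ p) * pauli p.1 p.2 = 1 := by
  rw [correction, hd.likelyError_map hp, pauli_conjTranspose_mul_self]

lemma isPauli_correction (s : ι → ZMod 2) : IsPauli (correction σ s) :=
  isPauli_pauli_conjTranspose _ _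

/-- The correction carries the syndrome it is meant for, so it shifts that sector to syndrome zero.
This also covers sectors that no error of weight at most one reaches; empty sectors are trivial. -/
lemma IsSyndrome.codeProj_mul_correction_mul (h : IsSyndrome g σ) (hP : codeProj g ≠ 0)
    (s : ι → ZMod 2) :
    codeProj g * (correction σ s * syndromeProj g s) = correction σ s * syndromeProj g s := by
  by_cases hs : syndromeProj g s = 0
  · simp [hs]
  have hσ := map_likelyError (h.exists_pauli hP hs)
  refine codeProj_mul_of_forall fun j => ?_
  rw [correction, pauli_conjTranspose, pauliZ_mul_pauliX, smul_mul_assoc, mul_smul_comm,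
    h.gen_mul_pauli_mul j _ _ (fun j => gen_mul_syndromeProj s j), Prod.mk.eta, hσ, vec_add_self,
    Pi.zero_apply, zsign_zero, one_smul]

lemma IsSyndrome.syndromeProj_mul_codeProj (h : IsSyndrome g σ) (s : ι → ZMod 2)
    [Decidable (s = 0)] :
    syndromeProj g s * codeProj g = if s = 0 then codeProj g else 0 := by
  classical
  have := h.syndromeProj_mul_pauli_mul_codeProj s 0 0
  rw [← Prod.zero_eq_mk, map_zero, pauli_zero, one_mul] at this
  rw [this]
  congr

/-- The operators supported on the code space from both sides. -/
def IsCodeOp (g : ι → Op n) (ρ : Op n) : Prop := codeProj g * ρ * codeProj g = ρ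

lemma IsCodeOp.codeProj_mul {ρ : Op n} (hρ : IsCodeOp g ρ) : codeProj g * ρ = ρ := by
  rw [← hρ, ← mul_assoc, ← mul_assoc, codeProj_mul_self]

lemma IsCodeOp.mul_codeProj {ρ : Op n} (hρ : IsCodeOp g ρ) : ρ * codeProj g = ρ := by
  rw [← hρ, mul_assoc, codeProj_mul_self]

lemma IsCodeOp.conjTranspose {ρ : Op n} (hρ : IsCodeOp g ρ) : IsCodeOp g ρᴴ := by
  have := congrArg Matrix.conjTranspose hρ
  rwa [Matrix.conjTranspose_mul, Matrix.conjTranspose_mul, codeProj_conjTranspose,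
    ← mul_assoc] at this

/-- The two-local operators act as scalars within the code space. -/
lemma IsSyndrome.codeProj_localOps (h : IsSyndrome g σ) (hd : DetectsTwo σ) {H : Op n}
    (hH : H ∈ localOps n 2) : ∃ κ : ℂ, codeProj g * H * codeProj g = κ • codeProj g := by
  -- Being scalar within the code is a linear condition, so it need only be checked on Pauli
  -- operators of weight at most 2.
  let D : Submodule ℂ (Op n) :=
    { carrier := {H | ∃ κ : ℂ, codeProj g * H * codeProj g = κ • codeProj g}
      add_mem' := by
        rintro x y ⟨κ, hx⟩ ⟨μ, hy⟩
        exact ⟨κ + μ, by rw [mul_add, add_mul, hx, hy, add_smul]⟩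
      zero_mem' := ⟨0, by simp⟩
      smul_mem' := by
        rintro c x ⟨κ, hx⟩
        exact ⟨c * κ, by rw [mul_smul_comm, smul_mul_assoc, hx, smul_smul]⟩ }
  suffices hle : localOps n 2 ≤ D from hle hH
  refine iSup₂_le fun s hs => Submodule.span_le.mpr ?_
  rintro _ ⟨a, b, hab, rfl⟩
  change ∃ κ : ℂ, codeProj g * pauli a b * codeProj g = κ • codeProj g
  by_cases h0 : σ (a, b) = 0
  · obtain ⟨rfl, rfl⟩ := hd a b ((weight_le_of_support hab).trans hs) h0
    exact ⟨1, by rw [pauli_zero, mul_one, codeProj_mul_self, one_smul]⟩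
  · exact ⟨0, by rw [h.codeProj_mul_pauli_mul_codeProj h0, zero_smul]⟩

variable [Fintype ι] [DecidableEq ι]

lemma recovery_apply (C : (ι → ZMod 2) → Op n) (x : Op n) : recovery g C x =
    ∑ s, C s * (syndromeProj g s * x * syndromeProj g s) * (C s)ᴴ := by
  simp [recovery, sandwich_apply, Matrix.conjTranspose_mul, syndromeProj_conjTranspose, mul_assoc]

lemma IsSyndrome.isCodeOp_recovery (h : IsSyndrome g σ) (hP : codeProj g ≠ 0) (x : Op n) :
    IsCodeOp g (recovery g (correction σ) x) := by
  have h1 := h.codeProj_mul_correction_mul hP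
  have h2 : ∀ s, (correction σ s * syndromeProj g s)ᴴ * codeProj g =
      (correction σ s * syndromeProj g s)ᴴ := fun s => by
    have := congrArg Matrix.conjTranspose (h1 s)
    rwa [Matrix.conjTranspose_mul, codeProj_conjTranspose] at this
  simp only [IsCodeOp, recovery, LinearMap.sum_apply, sandwich_apply, Finset.mul_sum,
    Finset.sum_mul]
  refine Finset.sum_congr rfl fun s _ => ?_
  rw [mul_assoc _ _ (codeProj g), mul_assoc _ _ (codeProj g), h2, ← mul_assoc, ← mul_assoc, h1]

/-- Distinct errors of weight at most one land in distinct sectors, so the measurement erases their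
cross terms; equal ones are undone exactly by the correction. -/
lemma IsSyndrome.recovery_pauli (h : IsSyndrome g σ) (hd : DetectsTwo σ)
    {p q : (Fin n → ZMod 2) × (Fin n → ZMod 2)} (hp : weight p.1 p.2 ≤ 1)
    (hq : weight q.1 q.2 ≤ 1) {ρ : Op n} (hρ : IsCodeOp g ρ) :
    recovery g (correction σ) (pauli p.1 p.2 * ρ * (pauli q.1 q.2)ᴴ) =
      if p = q then ρ else 0 := by
  have hterm : ∀ s, syndromeProj g s * (pauli p.1 p.2 * ρ * (pauli q.1 q.2)ᴴ) *
      syndromeProj g s = (if s = σ p then pauli p.1 p.2 * codeProj g else 0) * ρ *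
        (if s = σ q then pauli q.1 q.2 * codeProj g else 0)ᴴ := by
    intro s
    rw [← Prod.mk.eta (p := p), ← Prod.mk.eta (p := q),
      ← h.syndromeProj_mul_pauli_mul_codeProj, ← h.syndromeProj_mul_pauli_mul_codeProj,
      Matrix.conjTranspose_mul, Matrix.conjTranspose_mul, codeProj_conjTranspose,
      syndromeProj_conjTranspose]
    conv_lhs => rw [← hρ]
    simp only [mul_assoc]
  rw [recovery_apply]
  simp_rw [hterm]
  rw [Finset.sum_eq_single (σ p)]
  · by_cases hpq : p = q
    · subst hpq
      simp only [if_true, Matrix.conjTranspose_mul, codeProj_conjTranspose]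
      have h1 := hd.correction_mul_pauli hp
      have h2 := congrArg Matrix.conjTranspose h1
      rw [Matrix.conjTranspose_mul, Matrix.conjTranspose_one] at h2
      calc _ = (correction σ (σ p) * pauli p.1 p.2) * (codeProj g * ρ * codeProj g) *
            ((pauli p.1 p.2)ᴴ * (correction σ (σ p))ᴴ) := by simp only [mul_assoc]
        _ = ρ := by rw [h1, h2, hρ, one_mul, mul_one]
    · rw [if_neg fun h' => hpq (hd.eq_of_map_eq hp hq h'), if_neg hpq]
      simp
  · intro s _ hs
    simp [hs]
  · simp

lemma IsSyndrome.recovery_of_isCodeOp (h : IsSyndrome g σ) (hd : DetectsTwo σ) {ρ : Op n}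
    (hρ : IsCodeOp g ρ) : recovery g (correction σ) ρ = ρ := by
  simpa using h.recovery_pauli hd (p := 0) (q := 0) (by simp) (by simp) hρ

/-- On its right ρ has syndrome zero, so only that outcome contributes, and its correction is the
identity. -/
lemma IsSyndrome.recovery_mul_left (h : IsSyndrome g σ) (hd : DetectsTwo σ) (M : Op n) {ρ : Op n}
    (hρ : IsCodeOp g ρ) : recovery g (correction σ) (M * ρ) = codeProj g * M * ρ := by
  have hs : ∀ s, ρ * syndromeProj g s = if s = 0 then ρ else 0 := fun s => by
    have := congrArg Matrix.conjTranspose (h.syndromeProj_mul_codeProj s)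
    rw [Matrix.conjTranspose_mul, syndromeProj_conjTranspose, codeProj_conjTranspose] at this
    rw [← hρ.mul_codeProj, mul_assoc, this]
    split_ifs <;> simp [codeProj_conjTranspose]
  rw [recovery_apply, Finset.sum_eq_single 0]
  · rw [hd.correction_zero, mul_assoc _ _ (syndromeProj g 0), mul_assoc M, hs, if_pos rfl,
      Matrix.conjTranspose_one, one_mul, mul_one, mul_assoc]
    rfl
  · intro s _ h0
    rw [mul_assoc _ _ (syndromeProj g s), mul_assoc M, hs, if_neg h0]
    simp
  · simp

lemma recovery_conjTranspose (C : (ι → ZMod 2) → Op n) (x : Op n) :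
    recovery g C xᴴ = (recovery g C x)ᴴ := by
  simp [recovery_apply, Matrix.conjTranspose_sum, Matrix.conjTranspose_mul,
    syndromeProj_conjTranspose, mul_assoc]

lemma IsSyndrome.recovery_mul_right (h : IsSyndrome g σ) (hd : DetectsTwo σ) (M : Op n) {ρ : Op n}
    (hρ : IsCodeOp g ρ) : recovery g (correction σ) (ρ * M) = ρ * M * codeProj g := by
  have := congrArg Matrix.conjTranspose (h.recovery_mul_left hd Mᴴ hρ.conjTranspose)
  rwa [← recovery_conjTranspose, Matrix.conjTranspose_mul, Matrix.conjTranspose_mul,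
    Matrix.conjTranspose_mul, Matrix.conjTranspose_conjTranspose,
    Matrix.conjTranspose_conjTranspose, codeProj_conjTranspose, ← mul_assoc] at this

/-- The Knill–Laflamme condition for a pair of single-qubit operators. -/
lemma IsSyndrome.knillLaflamme (h : IsSyndrome g σ) (hd : DetectsTwo σ) {i : Fin n} {L M : Op n}
    (hL : L ∈ supportedOn {i}) (hM : M ∈ supportedOn {i}) :
    ∃ κ : ℂ, codeProj g * (Mᴴ * L) * codeProj g = κ • codeProj g ∧
      ∀ ρ, IsCodeOp g ρ → recovery g (correction σ) (L * ρ * Mᴴ) = κ • ρ := by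
  unfold supportedOn at hL hM
  induction hL, hM using Submodule.span_induction₂ with
  | mem_mem x y hx hy =>
    obtain ⟨a, b, hab, rfl⟩ := hx
    obtain ⟨a', b', hab', rfl⟩ := hy
    have hw := weight_le_of_support hab
    have hw' := weight_le_of_support hab'
    rw [Finset.card_singleton] at hw hw'
    -- For Pauli operators κ is a Kronecker delta; the remaining cases extend it linearly in L and
    -- conjugate-linearly in M.
    refine ⟨if (a, b) = (a', b') then 1 else 0, ?_, fun ρ hρ => ?_⟩
    · change codeProj g * ((pauli a' b')ᴴ * pauli a b) * codeProj g = _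
      split_ifs with hp
      · obtain ⟨rfl, rfl⟩ := Prod.mk.inj hp
        rw [pauli_conjTranspose_mul_self, mul_one, codeProj_mul_self, one_smul]
      · have hne : σ (a', b') ≠ σ (a, b) := fun h' => hp (hd.eq_of_map_eq hw hw' h'.symm)
        have h1 := h.syndromeProj_mul_pauli_mul_codeProj (σ (a', b')) a b
        have h2 := h.syndromeProj_mul_pauli_mul_codeProj (σ (a', b')) a' b'
        rw [if_neg hne] at h1
        rw [if_pos rfl] at h2
        have h3 := congrArg Matrix.conjTranspose h2
        simp only [Matrix.conjTranspose_mul, syndromeProj_conjTranspose,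
          codeProj_conjTranspose] at h3
        rw [zero_smul, ← mul_assoc, ← h3]
        calc _ = codeProj g * (pauli a' b')ᴴ *
              (syndromeProj g (σ (a', b')) * (pauli a b * codeProj g)) := by simp only [mul_assoc]
          _ = 0 := by rw [h1, mul_zero]
    · have := h.recovery_pauli hd (p := (a, b)) (q := (a', b')) hw hw' hρ
      rw [ite_smul, one_smul, zero_smul]
      exact this
  | zero_left y hy => exact ⟨0, by simp, by simp⟩
  | zero_right x hx => exact ⟨0, by simp, by simp⟩
  | add_left x y z _ _ _ h1 h2 =>
    obtain ⟨κ, h1, h1'⟩ := h1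
    obtain ⟨μ, h2, h2'⟩ := h2
    exact ⟨κ + μ, by rw [mul_add, mul_add, add_mul, h1, h2, add_smul], fun ρ hρ => by
      rw [add_mul, add_mul, map_add, h1' ρ hρ, h2' ρ hρ, add_smul]⟩
  | add_right x y z _ _ _ h1 h2 =>
    obtain ⟨κ, h1, h1'⟩ := h1
    obtain ⟨μ, h2, h2'⟩ := h2
    exact ⟨κ + μ, by rw [Matrix.conjTranspose_add, add_mul, mul_add, add_mul, h1, h2, add_smul],
      fun ρ hρ => by
        rw [Matrix.conjTranspose_add, mul_add, map_add, h1' ρ hρ, h2' ρ hρ, add_smul]⟩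
  | smul_left c x y _ _ h1 =>
    obtain ⟨κ, h1, h1'⟩ := h1
    exact ⟨c * κ, by rw [mul_smul_comm, mul_smul_comm, smul_mul_assoc, h1, smul_smul],
      fun ρ hρ => by rw [smul_mul_assoc, smul_mul_assoc, map_smul, h1' ρ hρ, smul_smul]⟩
  | smul_right c x y _ _ h1 =>
    obtain ⟨κ, h1, h1'⟩ := h1
    exact ⟨star c * κ, by
      rw [Matrix.conjTranspose_smul, smul_mul_assoc, mul_smul_comm, smul_mul_assoc, h1, smul_smul],
      fun ρ hρ => by
        rw [Matrix.conjTranspose_smul, mul_smul_comm, map_smul, h1' ρ hρ, smul_smul]⟩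

/-- On the code space, error correction reduces the noise generator to the commutator with the
projected interaction. -/
lemma IsSyndrome.recovery_lindbladian (h : IsSyndrome g σ) (hd : DetectsTwo σ) {q : ℕ}
    {L : Fin q → Op n} (hL : ∀ a, ∃ i, L a ∈ supportedOn {i}) {H₀ : Op n}
    (hH : H₀ ∈ localOps n 2) (ω : ℝ) {ρ : Op n} (hρ : IsCodeOp g ρ) :
    recovery g (correction σ) (lindbladian (ω • zzz n + H₀) L ρ) = effGenerator g ω ρ := by
  obtain ⟨κ, hκ⟩ := h.codeProj_localOps hd hH
  rw [effGenerator, lindbladian_elim0_apply, lindbladian_apply, map_add, map_sum]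
  -- The recovered jump term is μρ and the two halves of the anticommutator together give -μρ, with
  -- the same μ from Knill–Laflamme.
  have hnoise : ∀ a, recovery g (correction σ) (L a * ρ * (L a)ᴴ -
      (1 / 2 : ℂ) • ((L a)ᴴ * L a * ρ + ρ * ((L a)ᴴ * L a))) = 0 := by
    intro a
    obtain ⟨i, hi⟩ := hL a
    obtain ⟨μ, h1, h2⟩ := h.knillLaflamme hd hi hi
    have h3 : codeProj g * ((L a)ᴴ * L a) * ρ = μ • ρ := by
      rw [← hρ.codeProj_mul, ← mul_assoc, h1, smul_mul_assoc]
    have h4 : ρ * ((L a)ᴴ * L a) * codeProj g = μ • ρ := by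
      rw [← hρ.mul_codeProj, mul_assoc ρ, mul_assoc ρ, h1, mul_smul_comm]
    rw [map_sub, map_smul, map_add, h.recovery_mul_left hd _ hρ, h.recovery_mul_right hd _ hρ,
      h2 ρ hρ, h3, h4, ← two_smul ℂ, smul_smul]
    norm_num
  rw [Finset.sum_eq_zero fun a _ => hnoise a, add_zero, map_smul, map_sub,
    h.recovery_mul_left hd _ hρ, h.recovery_mul_right hd _ hρ]
  congr 1
  -- Within the code `H₀` contributes κρ on the left, and likewise on the right below, so it
  -- disappears from the commutator.
  have h5 : codeProj g * (ω • zzz n + H₀) * ρ =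
      ω • (codeProj g * zzz n * codeProj g) * ρ + κ • ρ := by
    conv_lhs => rw [← hρ.codeProj_mul]
    rw [← mul_assoc, mul_add, add_mul, add_mul, hκ, smul_mul_assoc κ, hρ.codeProj_mul]
    simp
  have h6 : ρ * (ω • zzz n + H₀) * codeProj g =
      ρ * ω • (codeProj g * zzz n * codeProj g) + κ • ρ := by
    conv_lhs => rw [← hρ.mul_codeProj]
    rw [mul_assoc, mul_assoc, ← mul_assoc (codeProj g), mul_add, add_mul, mul_add, hκ,
      mul_smul_comm κ, hρ.mul_codeProj]
    simp
  rw [h5, h6, add_sub_add_right_eq_sub]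

/-- Frequent error correction under single-qubit noise and two-local perturbations leads to the
evolution generated by the projected interaction. -/
theorem IsSyndrome.tendsto_controlled (h : IsSyndrome g σ) (hd : DetectsTwo σ)
    (hP : codeProj g ≠ 0) {q : ℕ}
    {L : Fin q → Op n} (hL : ∀ a, ∃ i, L a ∈ supportedOn {i}) {H₀ : Op n}
    (hH : H₀ ∈ localOps n 2) (ω t : ℝ) {ρ : Op n} (hρ : IsCodeOp g ρ) :
    Filter.Tendsto (fun N : ℕ => controlled (recovery g (correction σ))
      (lindbladian (ω • zzz n + H₀) L) t N ρ) Filter.atTop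
      (𝓝 (evolve (effGenerator g ω) t ρ)) := by
  refine tendsto_iterate_exp (R := LinearMap.toContinuousLinearMap (recovery g (correction σ)))
    (L := LinearMap.toContinuousLinearMap (lindbladian (ω • zzz n + H₀) L))
    (K := LinearMap.toContinuousLinearMap (effGenerator g ω)) ?_ ?_ t ?_
  · ext1 x
    exact h.recovery_of_isCodeOp hd (h.isCodeOp_recovery hP x)
  · ext1 x
    exact (h.recovery_lindbladian hd hL hH ω (h.isCodeOp_recovery hP x)).symm
  · exact h.recovery_of_isCodeOp hd hρ

end Recovery

/-! ### Shortened Reed–Muller codes -/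

section ReedMuller

variable {m : ℕ}

/-- The nonzero point of `𝔽₂^m` (given by its support) that indexes the column `j`. -/
def bits (m : ℕ) (j : Fin (2 ^ m - 1)) : Finset (Fin m) :=
  Finset.univ.filter fun i => ((j : ℕ) + 1).testBit i = true

/-- The monomial `∏_{i ∈ T} v_i` on the nonzero points. -/
def mono (T : Finset (Fin m)) (j : Fin (2 ^ m - 1)) : ZMod 2 := if T ⊆ bits m j then 1 else 0

lemma mem_bits {i : Fin m} {j : Fin (2 ^ m - 1)} :
    i ∈ bits m j ↔ ((j : ℕ) + 1).testBit i = true := by simp [bits]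

lemma shortGen_eq (r : ℕ) (T : ShortRow r m) : shortGen r m T = mono T.1 := by
  funext j
  simp [shortGen, rmGen, mono, Finset.subset_iff, mem_bits]

lemma bits_injective : Function.Injective (bits m) := by
  intro j k h
  have hlt : ∀ l : Fin (2 ^ m - 1), (l : ℕ) + 1 < 2 ^ m := fun l => by have := l.2; omega
  have : (j : ℕ) + 1 = (k : ℕ) + 1 := by
    refine Nat.eq_of_testBit_eq fun i => ?_
    by_cases hi : i < m
    · have := congrArg (fun s => (⟨i, hi⟩ : Fin m) ∈ s) h
      simpa only [mem_bits, eq_iff_iff, ← Bool.eq_iff_iff] using this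
    · rw [Nat.testBit_eq_false_of_lt, Nat.testBit_eq_false_of_lt]
      · exact (hlt k).trans_le (Nat.pow_le_pow_right two_pos (not_lt.mp hi))
      · exact (hlt j).trans_le (Nat.pow_le_pow_right two_pos (not_lt.mp hi))
  exact Fin.ext (by omega)

lemma bits_nonempty (j : Fin (2 ^ m - 1)) : (bits m j).Nonempty := by
  rw [Finset.nonempty_iff_ne_empty]
  intro h
  have hlt : (j : ℕ) + 1 < 2 ^ m := by have := j.2; omega
  have : (j : ℕ) + 1 = 0 := by
    refine Nat.eq_of_testBit_eq fun i => ?_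
    rw [Nat.zero_testBit]
    by_cases hi : i < m
    · have := Finset.notMem_empty (⟨i, hi⟩ : Fin m)
      rw [← h, mem_bits] at this
      simpa using this
    · exact Nat.testBit_eq_false_of_lt
        (hlt.trans_le (Nat.pow_le_pow_right two_pos (not_lt.mp hi)))
  omega

lemma empty_notMem_image_bits : ∅ ∉ Finset.univ.image (bits m) := by
  simp only [Finset.mem_image, Finset.mem_univ, true_and, not_exists]
  exact fun j hj => (bits_nonempty j).ne_empty hj

/-- By counting: n distinct nonempty sets together with the empty set make 2^m sets. -/
lemma insert_empty_image_bits : insert ∅ (Finset.univ.image (bits m)) = Finset.univ := by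
  refine Finset.eq_univ_of_card _ ?_
  rw [Finset.card_insert_of_notMem empty_notMem_image_bits,
    Finset.card_image_of_injective _ bits_injective]
  simp only [Finset.card_univ, Fintype.card_fin, Fintype.card_finset]
  exact Nat.sub_add_cancel Nat.one_le_two_pow

lemma exists_bits_eq {S : Finset (Fin m)} (hS : S.Nonempty) : ∃ j, bits m j = S := by
  have := Finset.mem_univ S
  rw [← insert_empty_image_bits, Finset.mem_insert] at this
  simpa using this.resolve_left hS.ne_empty

lemma sum_finset_eq {M : Type*} [AddCommMonoid M] (F : Finset (Fin m) → M) :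
    ∑ S, F S = F ∅ + ∑ j, F (bits m j) := by
  rw [← insert_empty_image_bits, Finset.sum_insert empty_notMem_image_bits,
    Finset.sum_image fun _ _ _ _ h => bits_injective h]

/-- T has 2^(m - |T|) supersets, an even number unless T is everything. Every orthogonality relation
here comes from this parity. -/
lemma sum_superset_eq_zero {T : Finset (Fin m)} (hT : T.card < m) :
    ∑ S : Finset (Fin m), (if T ⊆ S then 1 else 0 : ZMod 2) = 0 := by
  rw [Finset.sum_boole]
  have : (Finset.univ.filter fun S => T ⊆ S) = Finset.Icc T Finset.univ := by
    ext S; simp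
  rw [this, Finset.card_Icc_finset (Finset.subset_univ T), Finset.card_univ, Fintype.card_fin,
    Nat.cast_pow]
  exact zero_pow (by omega)

lemma sum_mono {T : Finset (Fin m)} (hT : T.Nonempty) (hTm : T.card < m) :
    ∑ j, mono T j = 0 := by
  have := sum_finset_eq fun S => (if T ⊆ S then 1 else 0 : ZMod 2)
  rw [sum_superset_eq_zero hTm, if_neg (by simpa using hT.ne_empty), zero_add] at this
  exact this.symm

lemma sum_one_eq_one (hm : 0 < m) : ∑ _j : Fin (2 ^ m - 1), (1 : ZMod 2) = 1 := by
  have := sum_finset_eq (m := m) fun S => (if ∅ ⊆ S then 1 else 0 : ZMod 2)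
  rw [sum_superset_eq_zero (by simpa using hm)] at this
  simp only [Finset.empty_subset, if_true] at this
  exact (CharTwo.add_eq_zero.mp this.symm).symm

lemma mono_mul (T U : Finset (Fin m)) (j : Fin (2 ^ m - 1)) :
    mono T j * mono U j = mono (T ∪ U) j := by
  by_cases h1 : T ⊆ bits m j <;> by_cases h2 : U ⊆ bits m j <;>
    simp [mono, h1, h2, Finset.union_subset_iff]

lemma mono_dotProduct_mono {T U : Finset (Fin m)} (hT : T.Nonempty) (h : T.card + U.card < m) :
    mono T ⬝ᵥ mono U = 0 := by
  simp only [dotProduct, mono_mul]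
  exact sum_mono (hT.mono Finset.subset_union_left) ((Finset.card_union_le _ _).trans_lt h)

lemma mono_dotProduct_one {T : Finset (Fin m)} (hT : T.Nonempty) (h : T.card < m) :
    mono T ⬝ᵥ 1 = 0 := by
  rw [dotProduct_one]
  exact sum_mono hT h

lemma one_dotProduct_one (hm : 0 < m) : (1 : Fin (2 ^ m - 1) → ZMod 2) ⬝ᵥ 1 = 1 := by
  rw [dotProduct_one]
  exact sum_one_eq_one hm

/-- A function on `𝔽₂^m` that is orthogonal to the monomials of degree at most `m - 2` and vanishes
at the points of weight at most one vanishes. -/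
lemma eq_zero_of_orthogonal {f : Finset (Fin m) → ZMod 2}
    (hf : ∀ T : Finset (Fin m), T.card ≤ m - 2 → ∑ S, (if T ⊆ S then f S else 0) = 0)
    (h0 : f ∅ = 0) (h1 : ∀ i, f {i} = 0) (S : Finset (Fin m)) : f S = 0 := by
  induction S using Finset.strongInduction with
  | H S ih =>
    by_cases hS : S.card ≤ 1
    · rcases Nat.le_one_iff_eq_zero_or_eq_one.mp hS with hc | hc
      · rw [Finset.card_eq_zero.mp hc, h0]
      · obtain ⟨i, rfl⟩ := Finset.card_eq_one.mp hc
        exact h1 i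
    have hc : Sᶜ.card ≤ m - 2 := by
      rw [Finset.card_compl, Fintype.card_fin]; omega
    -- Inclusion–exclusion mod 2: in the sum of these relations f U occurs 2^|Sᶜ ∩ U| times, so only
    -- subsets U of S survive. The degrees are allowed because |S| ≥ 2.
    have hsum : ∑ T ∈ Sᶜ.powerset, ∑ U, (if T ⊆ U then f U else 0) = 0 :=
      Finset.sum_eq_zero fun T hT =>
        hf T ((Finset.card_le_card (Finset.mem_powerset.mp hT)).trans hc)
    rw [Finset.sum_comm] at hsum
    have hterm : ∀ U : Finset (Fin m), ∑ T ∈ Sᶜ.powerset, (if T ⊆ U then f U else 0) =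
        if U ⊆ S then f U else 0 := by
      intro U
      rw [← Finset.sum_filter, Finset.sum_const, nsmul_eq_mul]
      have : (Sᶜ.powerset.filter fun T => T ⊆ U) = (Sᶜ ∩ U).powerset := by
        ext T
        rw [Finset.mem_filter, Finset.mem_powerset, Finset.mem_powerset, Finset.subset_inter_iff]
      rw [this, Finset.card_powerset]
      split_ifs with hU
      · have : Sᶜ ∩ U = ∅ := by
          rw [← Finset.disjoint_iff_inter_eq_empty, disjoint_comm]
          exact disjoint_compl_right_iff.mpr hU
        simp [this]
      · obtain ⟨x, hx, hxS⟩ := Finset.not_subset.mp hU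
        have hne : (Sᶜ ∩ U).card ≠ 0 := by
          rw [Finset.card_ne_zero]
          exact ⟨x, by simp [hx, hxS]⟩
        rw [Nat.cast_pow]
        have h2 : ((2 : ℕ) : ZMod 2) = 0 := by decide
        rw [h2, zero_pow hne, zero_mul]
    simp_rw [hterm] at hsum
    rw [Finset.sum_eq_single S] at hsum
    · simpa using hsum
    · intro U _ hU
      split_ifs with h
      · exact ih U (h.ssubset_of_ne hU)
      · rfl
    · simp

/-- The dual of the shortened `RM(m-2,m)` code is the punctured `RM(1,m)` code. -/
lemma exists_affine_of_orthogonal (hm : 2 ≤ m) {x : Fin (2 ^ m - 1) → ZMod 2}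
    (hx : ∀ T : Finset (Fin m), T.Nonempty → T.card ≤ m - 2 → mono T ⬝ᵥ x = 0) :
    ∃ (c : ZMod 2) (l : Fin m → ZMod 2), x = c • 1 + ∑ i, l i • mono {i} := by
  classical
  set c := ∑ j, x j with hc
  -- Extend x to the origin by its parity, so that orthogonality to the constant monomial holds as
  -- well.
  obtain ⟨e, he⟩ : ∃ e : Finset (Fin m) → ZMod 2, e ∅ = c ∧ ∀ j, e (bits m j) = x j := by
    refine ⟨fun S => if h : ∃ j, bits m j = S then x h.choose else c, ?_, fun j => ?_⟩
    · refine dif_neg ?_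
      rintro ⟨j, hj⟩
      exact (bits_nonempty j).ne_empty hj
    · have h : ∃ k, bits m k = bits m j := ⟨j, rfl⟩
      exact (dif_pos h).trans (congrArg x (bits_injective h.choose_spec))
  -- These coefficients make the affine function agree with e at the unit points; its constant term
  -- c matches e at the origin.
  set l : Fin m → ZMod 2 := fun i => e {i} + c with hl
  have key := eq_zero_of_orthogonal
    (f := fun S => e S + (c + ∑ i, l i * if i ∈ S then 1 else 0)) ?_ ?_ ?_
  · refine ⟨c, l, funext fun j => ?_⟩
    have := CharTwo.add_eq_zero.mp (key (bits m j))
    rw [he.2] at this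
    rw [this]
    simp [mono, Finset.sum_apply]
  · intro T hT
    -- A monomial of degree at most m - 2 times an affine function has degree at most m - 1, so its
    -- sum over the cube vanishes.
    have h1 : ∀ S : Finset (Fin m),
        (if T ⊆ S then e S + (c + ∑ i, l i * if i ∈ S then 1 else 0) else 0) =
        (if T ⊆ S then e S else 0) + (c * (if T ⊆ S then 1 else 0) +
          ∑ i, l i * if insert i T ⊆ S then 1 else 0) := by
      intro S
      by_cases hTS : T ⊆ S
      · simp [hTS, Finset.insert_subset_iff]
      · simp [hTS, Finset.insert_subset_iff]
    simp_rw [h1]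
    rw [Finset.sum_add_distrib, Finset.sum_add_distrib, ← Finset.mul_sum, Finset.sum_comm,
      sum_superset_eq_zero (by omega), mul_zero, zero_add]
    have h2 : ∑ i, ∑ S : Finset (Fin m), l i * (if insert i T ⊆ S then 1 else 0 : ZMod 2) = 0 := by
      refine Finset.sum_eq_zero fun i _ => ?_
      rw [← Finset.mul_sum, sum_superset_eq_zero
        ((Finset.card_insert_le i T).trans_lt (by omega)), mul_zero]
    rw [h2, add_zero, sum_finset_eq]
    simp_rw [he]
    rcases T.eq_empty_or_nonempty with rfl | hne
    · simp [← hc, zmod_two_add_self]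
    · rw [if_neg (by simpa using hne.ne_empty), zero_add]
      refine Eq.trans ?_ (hx T hne hT)
      simp [dotProduct, mono]
  · simp [he.1, zmod_two_add_self]
  · intro i
    simp only [Finset.mem_singleton, mul_ite, mul_one, mul_zero, Finset.sum_ite_eq',
      Finset.mem_univ, if_true, hl]
    rw [show e {i} + (c + (e {i} + c)) = (e {i} + e {i}) + (c + c) by ring, zmod_two_add_self,
      zmod_two_add_self, add_zero]

/-- The row space of the shortened Reed–Muller generator matrix. -/
def rmSpan (r m : ℕ) : Submodule (ZMod 2) (Fin (2 ^ m - 1) → ZMod 2) :=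
  Submodule.span (ZMod 2) (Set.range (shortGen r m))

lemma mono_mem_rmSpan {r : ℕ} {T : Finset (Fin m)} (hT : T.Nonempty) (h : T.card ≤ r) :
    mono T ∈ rmSpan r m :=
  Submodule.subset_span ⟨⟨T, hT, h⟩, shortGen_eq r _⟩

lemma dotProduct_eq_zero_of_mem_rmSpan {r : ℕ} {a x : Fin (2 ^ m - 1) → ZMod 2}
    (ha : a ∈ rmSpan r m)
    (hx : ∀ T : Finset (Fin m), T.Nonempty → T.card ≤ r → mono T ⬝ᵥ x = 0) : a ⬝ᵥ x = 0 := by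
  induction ha using Submodule.span_induction with
  | mem x hx' => obtain ⟨T, rfl⟩ := hx'; rw [shortGen_eq]; exact hx _ T.2.1 T.2.2
  | zero => simp
  | add x y _ _ h1 h2 => rw [add_dotProduct, h1, h2, add_zero]
  | smul c x _ h1 => rw [smul_dotProduct, h1, smul_zero]

lemma rmSpan_dotProduct_rmSpan {r s : ℕ} (h : r + s < m) {a b : Fin (2 ^ m - 1) → ZMod 2}
    (ha : a ∈ rmSpan r m) (hb : b ∈ rmSpan s m) : a ⬝ᵥ b = 0 := by
  refine dotProduct_eq_zero_of_mem_rmSpan ha fun T hT hTr => ?_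
  rw [dotProduct_comm]
  refine dotProduct_eq_zero_of_mem_rmSpan hb fun U hU hUs => ?_
  exact mono_dotProduct_mono hU (by omega)

lemma rmSpan_dotProduct_one {r : ℕ} (h : r < m) {a : Fin (2 ^ m - 1) → ZMod 2}
    (ha : a ∈ rmSpan r m) : a ⬝ᵥ 1 = 0 :=
  dotProduct_eq_zero_of_mem_rmSpan ha fun T hT hTr => mono_dotProduct_one hT (by omega)

/-- The words of even weight in the Hamming code form the shortened `RM(m-2,m)` code. -/
lemma mem_rmSpan_of_orthogonal (hm : 2 ≤ m) {b : Fin (2 ^ m - 1) → ZMod 2}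
    (hb : ∀ i, mono {i} ⬝ᵥ b = 0) (hb1 : 1 ⬝ᵥ b = 0) : b ∈ rmSpan (m - 2) m := by
  by_contra hnot
  -- A functional that separates b from the row space is a dot product with a vector orthogonal to
  -- all rows. That vector is affine, and b is orthogonal to affine functions.
  obtain ⟨f, hf0, hf⟩ := Submodule.exists_le_ker_of_notMem hnot
  have hdot : ∀ y, f y = (fun j => f (Pi.single j 1)) ⬝ᵥ y := by
    intro y
    conv_lhs => rw [← Finset.univ_sum_single y]
    rw [map_sum, dotProduct]
    refine Finset.sum_congr rfl fun j _ => ?_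
    rw [mul_comm, ← smul_eq_mul, ← map_smul, ← Pi.single_smul, smul_eq_mul, mul_one]
  obtain ⟨c, l, hx⟩ := exists_affine_of_orthogonal hm (x := fun j => f (Pi.single j 1))
    fun T hT hTm => by
      rw [dotProduct_comm, ← hdot]
      exact hf (mono_mem_rmSpan hT hTm)
  rw [hdot, hx, add_dotProduct, smul_dotProduct, hb1, sum_dotProduct,
    Finset.sum_eq_zero fun i _ => by rw [smul_dotProduct, hb i, smul_zero]] at hf0
  simp at hf0

/-- The minimum weight of the Hamming code is at least `3`. -/
lemma three_le_card_of_orthogonal {b : Fin (2 ^ m - 1) → ZMod 2}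
    (hb : ∀ i, mono {i} ⬝ᵥ b = 0) (h0 : b ≠ 0) :
    3 ≤ (Finset.univ.filter fun j => b j ≠ 0).card := by
  set s := Finset.univ.filter fun j => b j ≠ 0 with hs
  have hsum : ∀ i, ∑ j ∈ s, (if i ∈ bits m j then 1 else 0 : ZMod 2) = 0 := by
    intro i
    refine Eq.trans ?_ (hb i)
    rw [dotProduct, hs, Finset.sum_filter]
    refine Finset.sum_congr rfl fun j _ => ?_
    rcases zmod_two_cases (b j) with h | h <;> simp [h, mono]
  by_contra! hlt
  -- Weight 1 would need a zero column among the parity checks, weight 2 two equal columns.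
  interval_cases hc : s.card
  · refine h0 (funext fun j => ?_)
    by_contra hj
    have : j ∈ s := by simpa [hs] using hj
    rw [Finset.card_eq_zero.mp hc] at this
    exact Finset.notMem_empty _ this
  · obtain ⟨j, hj⟩ := Finset.card_eq_one.mp hc
    obtain ⟨i, hi⟩ := bits_nonempty j
    have := hsum i
    rw [hj, Finset.sum_singleton, if_pos hi] at this
    exact one_ne_zero this
  · obtain ⟨j, k, hjk, hj⟩ := Finset.card_eq_two.mp hc
    refine hjk (bits_injective (Finset.ext fun i => ?_))
    have := hsum i
    rw [hj, Finset.sum_pair hjk] at this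
    by_cases h1 : i ∈ bits m j <;> by_cases h2 : i ∈ bits m k <;> simp [h1, h2] at this ⊢

end ReedMuller

/-! ### Lines of the projective space -/

section Triples

variable {m : ℕ}

/-- The indicator vector of a set of columns. -/
def ind {α : Type*} [DecidableEq α] (T : Finset α) : α → ZMod 2 := fun i => if i ∈ T then 1 else 0

lemma dotProduct_ind {α : Type*} [DecidableEq α] [Fintype α] (x : α → ZMod 2) (T : Finset α) :
    x ⬝ᵥ ind T = ∑ i ∈ T, x i := by
  simp [dotProduct, ind]

/-- The words of weight `3` of the Hamming code. -/
def lines (m : ℕ) : Finset (Finset (Fin (2 ^ m - 1))) :=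
  (Finset.powersetCard 3 Finset.univ).filter fun T => ∀ i, mono {i} ⬝ᵥ ind T = 0

lemma mem_lines {T : Finset (Fin (2 ^ m - 1))} :
    T ∈ lines m ↔ T.card = 3 ∧ ∀ i, mono {i} ⬝ᵥ ind T = 0 := by
  simp [lines, Finset.mem_powersetCard]

lemma mono_singleton (i : Fin m) (j : Fin (2 ^ m - 1)) :
    mono {i} j = if i ∈ bits m j then 1 else 0 := by simp [mono]

lemma eq_of_mono_eq {j k : Fin (2 ^ m - 1)} (h : ∀ i, mono {i} j = mono {i} k) : j = k := by
  refine bits_injective (Finset.ext fun i => ?_)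
  have := h i
  rw [mono_singleton, mono_singleton] at this
  by_cases h1 : i ∈ bits m j <;> by_cases h2 : i ∈ bits m k <;> simp [h1, h2] at this ⊢

/-- Every line is determined by two of its points. -/
lemma exists_third {j k : Fin (2 ^ m - 1)} {T : Finset (Fin (2 ^ m - 1))} (hT : T ∈ lines m)
    (hj : j ∈ T) (hk : k ∈ T) (hjk : j ≠ k) :
    ∃ l, T = {j, k, l} ∧ ∀ i, mono {i} l = mono {i} j + mono {i} k := by
  obtain ⟨hc, hT⟩ := mem_lines.mp hT
  have h1 : ((T.erase j).erase k).card = 1 := by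
    rw [Finset.card_erase_of_mem (Finset.mem_erase.mpr ⟨hjk.symm, hk⟩),
      Finset.card_erase_of_mem hj, hc]
  obtain ⟨l, hl⟩ := Finset.card_eq_one.mp h1
  have hlm : l ∈ (T.erase j).erase k := by rw [hl]; exact Finset.mem_singleton_self l
  have hlk : l ≠ k := (Finset.mem_erase.mp hlm).1
  have hlj : l ≠ j := (Finset.mem_erase.mp (Finset.mem_erase.mp hlm).2).1
  have hTe : T = {j, k, l} := by
    rw [← hl, Finset.insert_erase (Finset.mem_erase.mpr ⟨hjk.symm, hk⟩), Finset.insert_erase hj]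
  refine ⟨l, hTe, fun i => ?_⟩
  have := hT i
  rw [dotProduct_ind, hTe, Finset.sum_insert (by simp [hjk, hlj.symm]),
    Finset.sum_pair hlk.symm, ← add_assoc] at this
  exact (CharTwo.add_eq_zero.mp this).symm

/-- The third point is the sum of the two, whose support is the symmetric difference of theirs. -/
lemma exists_line {j k : Fin (2 ^ m - 1)} (hjk : j ≠ k) : ∃ T ∈ lines m, j ∈ T ∧ k ∈ T := by
  have hne : (symmDiff (bits m j) (bits m k)).Nonempty := by
    rw [Finset.nonempty_iff_ne_empty, ← Finset.bot_eq_empty, Ne, symmDiff_eq_bot]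
    exact fun h => hjk (bits_injective h)
  obtain ⟨l, hl⟩ := exists_bits_eq hne
  have hlj : l ≠ j := by
    rintro rfl
    rw [eq_comm, symmDiff_eq_left] at hl
    exact (bits_nonempty k).ne_empty hl
  have hlk : l ≠ k := by
    rintro rfl
    rw [eq_comm, symmDiff_eq_right] at hl
    exact (bits_nonempty j).ne_empty hl
  refine ⟨{j, k, l}, mem_lines.mpr ⟨Finset.card_eq_three.mpr
    ⟨j, k, l, hjk, hlj.symm, hlk.symm, rfl⟩, fun i => ?_⟩, by simp, by simp⟩
  rw [dotProduct_ind, Finset.sum_insert (by simp [hjk, hlj.symm]), Finset.sum_pair hlk.symm]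
  simp only [mono_singleton, hl, Finset.mem_symmDiff]
  by_cases h1 : i ∈ bits m j <;> by_cases h2 : i ∈ bits m k <;> simp [h1, h2, zmod_two_add_self]

/-- Double counting: the ordered pairs of distinct points are partitioned by the line through them,
with six pairs on each line. -/
lemma six_mul_card_lines (m : ℕ) :
    6 * (lines m).card = (2 ^ m - 1) * ((2 ^ m - 1) - 1) := by
  have hU : (Finset.univ : Finset (Fin (2 ^ m - 1))).offDiag =
      (lines m).biUnion Finset.offDiag := by
    ext ⟨j, k⟩
    simp only [Finset.mem_offDiag, Finset.mem_univ, true_and, Finset.mem_biUnion]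
    constructor
    · intro hjk
      obtain ⟨T, hT, hj, hk⟩ := exists_line hjk
      exact ⟨T, hT, hj, hk, hjk⟩
    · rintro ⟨T, _, _, _, hjk⟩
      exact hjk
  have hcard := congrArg Finset.card hU
  rw [Finset.card_biUnion, Finset.offDiag_card, Finset.card_univ, Fintype.card_fin] at hcard
  · rw [Finset.sum_congr rfl fun T hT => by
      rw [Finset.offDiag_card, (mem_lines.mp hT).1], Finset.sum_const, smul_eq_mul] at hcard
    rw [Nat.mul_sub, mul_one, hcard, mul_comm]
  · intro T hT T' hT' hne
    rw [Function.onFun, Finset.disjoint_left]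
    rintro ⟨j, k⟩ h1 h2
    rw [Finset.mem_offDiag] at h1 h2
    obtain ⟨l, rfl, hl⟩ := exists_third hT h1.1 h1.2.1 h1.2.2
    obtain ⟨l', rfl, hl'⟩ := exists_third hT' h2.1 h2.2.1 h2.2.2
    exact hne (by rw [eq_of_mono_eq fun i => (hl i).trans (hl' i).symm])

end Triples

/-! ### The quantum Reed–Muller code -/

section Code

variable {m : ℕ}

lemma qrm_inl (T : ShortRow 1 m) : qrm m (Sum.inl T) = pauli (mono T.1) 0 := by
  rw [qrm, shortGen_eq, pauli_zero_right]

lemma qrm_inr (T : ShortRow (m - 2) m) : qrm m (Sum.inr T) = pauli 0 (mono T.1) := by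
  rw [qrm, shortGen_eq, pauli_zero_left]

/-- The syndromes of the Pauli operators for the quantum Reed–Muller code. -/
def qrmSyndrome (m : ℕ) : (Fin (2 ^ m - 1) → ZMod 2) × (Fin (2 ^ m - 1) → ZMod 2) →+
    (ShortRow 1 m ⊕ ShortRow (m - 2) m → ZMod 2) where
  toFun p := Sum.elim (fun T => mono T.1 ⬝ᵥ p.2) (fun T => mono T.1 ⬝ᵥ p.1)
  map_zero' := by funext j; cases j <;> simp
  map_add' p q := by funext j; cases j <;> simp [dotProduct_add]

lemma qrmSyndrome_eq_zero {a b : Fin (2 ^ m - 1) → ZMod 2} : qrmSyndrome m (a, b) = 0 ↔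
    (∀ i, mono {i} ⬝ᵥ b = 0) ∧
      ∀ T : Finset (Fin m), T.Nonempty → T.card ≤ m - 2 → mono T ⬝ᵥ a = 0 := by
  rw [funext_iff, Sum.forall]
  refine and_congr ⟨fun h i => h ⟨{i}, by simp, by simp⟩, ?_⟩
    ⟨fun h T hT hc => h ⟨T, hT, hc⟩, fun h T => h _ T.2.1 T.2.2⟩
  rintro h ⟨T, hT, hc⟩
  obtain ⟨i, rfl⟩ := Finset.card_eq_one.mp (le_antisymm hc hT.card_pos)
  exact h i

lemma isSyndrome_qrm (m : ℕ) : IsSyndrome (qrm m) (qrmSyndrome m) where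
  herm j := by
    cases j
    · exact pauliX_conjTranspose _
    · exact pauliZ_conjTranspose _
  comm j a b := by
    cases j with
    | inl T => rw [qrm_inl, pauli_mul_comm, zero_dotProduct, zero_add, dotProduct_comm]; rfl
    | inr T => rw [qrm_inr, pauli_mul_comm, dotProduct_zero, add_zero]; rfl

/-- Both parts are Hamming words and so vanish or have weight at least 3. For the X part, m ≥ 3 puts
the degree-one monomials among the Z-type checks. -/
lemma detectsTwo_qrm (hm : 3 ≤ m) : DetectsTwo (qrmSyndrome m) := by
  intro a b hw h
  obtain ⟨hb, ha⟩ := qrmSyndrome_eq_zero.mp h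
  constructor
  · by_contra h0
    have := three_le_card_of_orthogonal
      (fun i => ha {i} (Finset.singleton_nonempty i) (by rw [Finset.card_singleton]; omega)) h0
    have hle : (Finset.univ.filter fun j => a j ≠ 0).card ≤ weight a b :=
      Finset.card_le_card (Finset.monotone_filter_right _ fun _ _ => Or.inl)
    omega
  · by_contra h0
    have := three_le_card_of_orthogonal hb h0
    have hle : (Finset.univ.filter fun j => b j ≠ 0).card ≤ weight a b :=
      Finset.card_le_card (Finset.monotone_filter_right _ fun _ _ => Or.inr)
    omega

lemma pauliX_mem_stabilizer {a : Fin (2 ^ m - 1) → ZMod 2} (ha : a ∈ rmSpan 1 m) :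
    pauliX a ∈ stabilizer (qrm m) := by
  induction ha using Submodule.span_induction with
  | mem x hx => obtain ⟨T, rfl⟩ := hx; exact Submonoid.subset_closure ⟨Sum.inl T, rfl⟩
  | zero => rw [pauliX_zero]; exact one_mem _
  | add x y _ _ h1 h2 => rw [← pauliX_mul]; exact mul_mem h1 h2
  | smul c x _ h1 =>
    rcases zmod_two_cases c with rfl | rfl
    · rw [zero_smul, pauliX_zero]; exact one_mem _
    · rwa [one_smul]

lemma pauliZ_mem_stabilizer {b : Fin (2 ^ m - 1) → ZMod 2} (hb : b ∈ rmSpan (m - 2) m) :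
    pauliZ b ∈ stabilizer (qrm m) := by
  induction hb using Submodule.span_induction with
  | mem x hx => obtain ⟨T, rfl⟩ := hx; exact Submonoid.subset_closure ⟨Sum.inr T, rfl⟩
  | zero => rw [pauliZ_zero]; exact one_mem _
  | add x y _ _ h1 h2 => rw [← pauliZ_mul]; exact mul_mem h1 h2
  | smul c x _ h1 =>
    rcases zmod_two_cases c with rfl | rfl
    · rw [zero_smul, pauliZ_zero]; exact one_mem _
    · rwa [one_smul]

/-- The degrees 1 and m - 2 add to less than m, so X and Z parts commute and products of generators
acquire no sign. -/
lemma mem_stabilizer_qrm (hm : 2 ≤ m) {Q : Op (2 ^ m - 1)} : Q ∈ stabilizer (qrm m) ↔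
    ∃ a ∈ rmSpan 1 m, ∃ b ∈ rmSpan (m - 2) m, Q = pauli a b := by
  constructor
  · intro hQ
    induction hQ using Submonoid.closure_induction with
    | mem x hx =>
      obtain ⟨T | T, rfl⟩ := hx
      · exact ⟨_, mono_mem_rmSpan T.2.1 T.2.2, 0, zero_mem _, qrm_inl T⟩
      · exact ⟨0, zero_mem _, _, mono_mem_rmSpan T.2.1 T.2.2, qrm_inr T⟩
    | one => exact ⟨0, zero_mem _, 0, zero_mem _, pauli_zero.symm⟩
    | mul x y _ _ h1 h2 =>
      obtain ⟨a, ha, b, hb, rfl⟩ := h1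
      obtain ⟨a', ha', b', hb', rfl⟩ := h2
      refine ⟨a + a', add_mem ha ha', b + b', add_mem hb hb', ?_⟩
      rw [pauli_mul, rmSpan_dotProduct_rmSpan (by omega) hb ha', zsign_zero, one_smul]
  · rintro ⟨a, ha, b, hb, rfl⟩
    exact mul_mem (pauliX_mem_stabilizer ha) (pauliZ_mem_stabilizer hb)

lemma commute_pauli_iff {n : ℕ} {a b a' b' : Fin n → ZMod 2} :
    Commute (pauli a b) (pauli a' b') ↔ b ⬝ᵥ a' + b' ⬝ᵥ a = 0 := by
  rw [commute_iff_eq, pauli_mul_comm]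
  constructor
  · intro h
    rw [pauli_mul, smul_smul] at h
    exact zsign_injective ((mul_eq_right₀ (zsign_ne_zero _)).mp (smul_pauli_inj
      (mul_ne_zero (zsign_ne_zero _) (zsign_ne_zero _)) h).2.2 |>.trans zsign_zero.symm)
  · intro h
    rw [h, zsign_zero, one_smul]

lemma commute_stabilizer_iff {P : Op (2 ^ m - 1)} :
    (∀ Q ∈ stabilizer (qrm m), Commute P Q) ↔ ∀ j, Commute P (qrm m j) := by
  refine ⟨fun h j => h _ (Submonoid.subset_closure ⟨j, rfl⟩), fun h Q hQ => ?_⟩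
  induction hQ using Submonoid.closure_induction with
  | mem x hx => obtain ⟨j, rfl⟩ := hx; exact h j
  | one => exact Commute.one_right P
  | mul x y _ _ h1 h2 => exact h1.mul_right h2

lemma commute_pauli_qrm_iff {a b : Fin (2 ^ m - 1) → ZMod 2} :
    (∀ j, Commute (pauli a b) (qrm m j)) ↔ qrmSyndrome m (a, b) = 0 := by
  rw [funext_iff]
  refine forall_congr' fun j => ?_
  cases j with
  | inl T =>
    rw [qrm_inl, commute_pauli_iff, zero_dotProduct, add_zero, dotProduct_comm]; rfl
  | inr T => rw [qrm_inr, commute_pauli_iff, dotProduct_zero, zero_add]; rfl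

lemma I_pow_smul_I_pow_smul {n : ℕ} (k : ℕ) (P : Op n) :
    Complex.I ^ (3 * k) • Complex.I ^ k • P = P := by
  rw [smul_smul, ← pow_add, show 3 * k + k = 4 * k by ring, pow_mul, Complex.I_pow_four, one_pow,
    one_smul]

lemma isLogical_smul_pauli_iff (hm : 2 ≤ m) {k : ℕ} {a b : Fin (2 ^ m - 1) → ZMod 2} :
    IsLogical (qrm m) (Complex.I ^ k • pauli a b) ↔
      qrmSyndrome m (a, b) = 0 ∧ ¬ (a ∈ rmSpan 1 m ∧ b ∈ rmSpan (m - 2) m) := by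
  have hP : IsPauli (Complex.I ^ k • pauli a b) := ⟨_, k, a, b, rfl, rfl⟩
  have hc : (∀ Q ∈ stabilizer (qrm m), Commute (Complex.I ^ k • pauli a b) Q) ↔
      qrmSyndrome m (a, b) = 0 := by
    rw [commute_stabilizer_iff, ← commute_pauli_qrm_iff]
    exact forall_congr' fun j => Commute.smul_left_iff₀ (I_pow_ne_zero k)
  rw [IsLogical, hc]
  refine (and_iff_right hP).trans (and_congr_right fun _ => ?_)
  constructor
  · rintro h ⟨ha, hb⟩
    -- The phase I^(3k) undoes I^k because I^4 = 1.
    refine h (3 * k) ?_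
    rw [I_pow_smul_I_pow_smul]
    exact (mem_stabilizer_qrm hm).mpr ⟨a, ha, b, hb, rfl⟩
  · intro h l hl
    obtain ⟨a', ha', b', hb', he⟩ := (mem_stabilizer_qrm hm).mp hl
    rw [smul_smul, ← one_smul ℂ (pauli a' b')] at he
    obtain ⟨rfl, rfl, -⟩ := smul_pauli_inj (mul_ne_zero (I_pow_ne_zero _) (I_pow_ne_zero _)) he
    exact h ⟨ha', hb'⟩

lemma isLogical_pauli_iff (hm : 2 ≤ m) {a b : Fin (2 ^ m - 1) → ZMod 2} :
    IsLogical (qrm m) (pauli a b) ↔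
      qrmSyndrome m (a, b) = 0 ∧ ¬ (a ∈ rmSpan 1 m ∧ b ∈ rmSpan (m - 2) m) := by
  simpa using isLogical_smul_pauli_iff hm (k := 0) (a := a) (b := b)

/-- Z parts of stabilizers have even weight, so a string of odd weight is never a stabilizer, and
commutation is all there is to check. -/
lemma isLogical_pauliZ_iff (hm : 2 ≤ m) {b : Fin (2 ^ m - 1) → ZMod 2} (hb : b ⬝ᵥ 1 = 1) :
    IsLogical (qrm m) (pauliZ b) ↔ ∀ i, mono {i} ⬝ᵥ b = 0 := by
  rw [← pauli_zero_left, isLogical_pauli_iff hm, qrmSyndrome_eq_zero]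
  refine ⟨fun h => h.1.1, fun h => ⟨⟨h, fun T _ _ => dotProduct_zero _⟩, fun h' => ?_⟩⟩
  rw [rmSpan_dotProduct_one (by omega) h'.2] at hb
  exact zero_ne_one hb

lemma mono_singleton_dotProduct_one (hm : 2 ≤ m) (i : Fin m) : mono {i} ⬝ᵥ 1 = 0 :=
  mono_dotProduct_one (Finset.singleton_nonempty i) (by rw [Finset.card_singleton]; omega)

lemma isLogical_logicalZ (hm : 2 ≤ m) : IsLogical (qrm m) (logicalZ m) :=
  (isLogical_pauliZ_iff hm (one_dotProduct_one (by omega))).mpr (mono_singleton_dotProduct_one hm)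

/-! ### Weight-three Z strings and the distance -/

lemma zString_eq {n : ℕ} (T : Finset (Fin n)) : zString T = pauliZ (ind T) := rfl

lemma ind_dotProduct_one {n : ℕ} {T : Finset (Fin n)} (hT : T.card = 3) : ind T ⬝ᵥ 1 = 1 := by
  rw [dotProduct_comm, dotProduct_ind]
  simp only [Pi.one_apply, Finset.sum_const, hT]
  decide

lemma isLogical_zString_iff (hm : 2 ≤ m) {T : Finset (Fin (2 ^ m - 1))} :
    T.card = 3 ∧ IsLogical (qrm m) (zString T) ↔ T ∈ lines m := by
  rw [mem_lines]
  exact and_congr_right fun hT => isLogical_pauliZ_iff hm (ind_dotProduct_one hT)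

lemma ncard_logical_zString (hm : 2 ≤ m) :
    {T : Finset (Fin (2 ^ m - 1)) | T.card = 3 ∧ IsLogical (qrm m) (zString T)}.ncard =
      (lines m).card := by
  rw [← Set.ncard_coe_finset]
  exact congrArg Set.ncard (Set.ext fun T => isLogical_zString_iff hm)

lemma weight_zero_ind {n : ℕ} (T : Finset (Fin n)) : weight 0 (ind T) = T.card := by
  unfold weight
  congr 1
  ext i
  simp [ind]

lemma eq_ind_support {n : ℕ} (b : Fin n → ZMod 2) :
    b = ind (Finset.univ.filter fun j => b j ≠ 0) := by
  funext j
  rcases zmod_two_cases (b j) with h | h <;> simp [ind, h]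

lemma zString_injective {n : ℕ} : Function.Injective (zString : Finset (Fin n) → Op n) := by
  intro T T' h
  rw [zString_eq, zString_eq, ← pauli_zero_left, ← pauli_zero_left] at h
  have := (pauli_inj h).2
  ext i
  have := congrFun this i
  by_cases h1 : i ∈ T <;> by_cases h2 : i ∈ T' <;> simp [ind, h1, h2] at this ⊢

/-- The product of `Z^{⊗ n}` with a weight-three logical `Z` string is a stabilizer. -/
lemma pauliZ_add_one_mem_stabilizer (hm : 2 ≤ m) {T : Finset (Fin (2 ^ m - 1))}
    (hT : T ∈ lines m) : pauliZ (1 + ind T) ∈ stabilizer (qrm m) := by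
  obtain ⟨hc, hT⟩ := mem_lines.mp hT
  refine pauliZ_mem_stabilizer (mem_rmSpan_of_orthogonal hm (fun i => ?_) ?_)
  · rw [dotProduct_add, hT, mono_singleton_dotProduct_one hm, add_zero]
  · rw [dotProduct_add, one_dotProduct_one (by omega), dotProduct_comm, ind_dotProduct_one hc]
    exact zmod_two_add_self 1

lemma logicalZ_mul_pauliZ (b : Fin (2 ^ m - 1) → ZMod 2) :
    logicalZ m * pauliZ (1 + b) = pauliZ b := by
  rw [logicalZ, pauliZ_mul, ← add_assoc, vec_add_self, zero_add]

lemma representatives_eq (hm : 3 ≤ m) :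
    {P | IsPauliOfWeight 3 P ∧ ∃ Q ∈ stabilizer (qrm m), P = logicalZ m * Q} =
      zString '' (lines m : Set (Finset (Fin (2 ^ m - 1)))) := by
  ext P
  constructor
  · rintro ⟨⟨k, a, b, hw, hP⟩, Q, hQ, hPQ⟩
    obtain ⟨a', ha', b', hb', rfl⟩ := (mem_stabilizer_qrm (by omega)).mp hQ
    have hodd : a' ⬝ᵥ 1 = 0 := rmSpan_dotProduct_one (by omega) ha'
    rw [logicalZ, ← pauli_zero_left, pauli_mul, dotProduct_comm, hodd, zsign_zero, one_smul,
      zero_add] at hPQ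
    obtain ⟨rfl, rfl, -⟩ := smul_pauli_inj (I_pow_ne_zero k)
      (c' := 1) (hP.symm.trans (hPQ.trans (one_smul ℂ _).symm))
    -- The X part is a Hamming word of even weight; if nonzero it would have weight at least 4,
    -- exceeding the total weight 3.
    have h0 : a = 0 := by
      by_contra hne
      have h3 := three_le_card_of_orthogonal (fun i => rmSpan_dotProduct_rmSpan (r := 1) (s := 1)
        (by omega) (mono_mem_rmSpan (Finset.singleton_nonempty i) (by simp)) ha') hne
      have hle : (Finset.univ.filter fun j => a j ≠ 0).card ≤ weight a (1 + b') :=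
        Finset.card_le_card (Finset.monotone_filter_right _ fun _ _ => Or.inl)
      rw [eq_ind_support a, ind_dotProduct_one (by omega)] at hodd
      exact one_ne_zero hodd
    subst h0
    set T := Finset.univ.filter fun j => (1 + b') j ≠ 0 with hT
    have hbT : 1 + b' = ind T := eq_ind_support _
    refine ⟨T, mem_lines.mpr ⟨?_, fun i => ?_⟩, ?_⟩
    · rwa [hbT, weight_zero_ind] at hw
    · rw [← hbT, dotProduct_add, mono_singleton_dotProduct_one (by omega), zero_add]
      exact rmSpan_dotProduct_rmSpan (r := 1) (s := m - 2)
        (by omega) (mono_mem_rmSpan (Finset.singleton_nonempty i) (by simp)) hb'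
    · rw [hPQ, hbT, pauli_zero_left, zString_eq]
  · rintro ⟨T, hT, rfl⟩
    refine ⟨⟨0, 0, ind T, ?_, ?_⟩, _, pauliZ_add_one_mem_stabilizer (by omega) hT,
      (logicalZ_mul_pauliZ _).symm⟩
    · rw [weight_zero_ind, (mem_lines.mp hT).1]
    · rw [pow_zero, one_smul, pauliX_zero, one_mul, zString_eq]

lemma ncard_representatives (hm : 3 ≤ m) :
    {P | IsPauliOfWeight 3 P ∧ ∃ Q ∈ stabilizer (qrm m), P = logicalZ m * Q}.ncard =
      (lines m).card := by
  rw [representatives_eq hm, Set.ncard_image_of_injective _ zString_injective,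
    Set.ncard_coe_finset]

lemma lines_nonempty (hm : 2 ≤ m) : (lines m).Nonempty := by
  rw [← Finset.card_pos]
  have h := six_mul_card_lines m
  have h4 : 2 ^ 2 ≤ 2 ^ m := Nat.pow_le_pow_right two_pos hm
  have : 0 < (2 ^ m - 1) * ((2 ^ m - 1) - 1) := Nat.mul_pos (by omega) (by omega)
  omega

lemma isLeast_logical_weight (hm : 3 ≤ m) :
    IsLeast {w | ∃ P, IsPauliOfWeight w P ∧ IsLogical (qrm m) P} 3 := by
  constructor
  · obtain ⟨T, hT⟩ := lines_nonempty (m := m) (by omega)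
    have h := (isLogical_zString_iff (by omega)).mpr hT
    refine ⟨zString T, ⟨0, 0, ind T, ?_, ?_⟩, h.2⟩
    · rw [weight_zero_ind, h.1]
    · rw [pow_zero, one_smul, pauliX_zero, one_mul, zString_eq]
  · rintro w ⟨_, ⟨k, a, b, rfl, rfl⟩, hl⟩
    obtain ⟨h0, hn⟩ := (isLogical_smul_pauli_iff (by omega)).mp hl
    by_contra! hlt
    obtain ⟨rfl, rfl⟩ := detectsTwo_qrm hm a b (by omega) h0
    exact hn ⟨zero_mem _, zero_mem _⟩

lemma commute_qrm (hm : 2 ≤ m) (i j : ShortRow 1 m ⊕ ShortRow (m - 2) m) :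
    Commute (qrm m i) (qrm m j) := by
  have key : ∀ Q ∈ stabilizer (qrm m), qrm m i * Q = Q * qrm m i := by
    intro Q hQ
    obtain ⟨a, ha, b, hb, rfl⟩ := (mem_stabilizer_qrm hm).mp hQ
    obtain ⟨a', ha', b', hb', he⟩ := (mem_stabilizer_qrm hm).mp
      (Submonoid.subset_closure ⟨i, rfl⟩ : qrm m i ∈ stabilizer (qrm m))
    rw [he]
    refine commute_pauli_iff.mpr ?_
    rw [rmSpan_dotProduct_rmSpan (by omega) hb' ha, rmSpan_dotProduct_rmSpan (by omega) hb ha',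
      add_zero]
  exact key _ (Submonoid.subset_closure ⟨j, rfl⟩)

end Code

/-! ### The code space -/

section CodeSpace

lemma toEuclideanLin_pauliX_apply {n : ℕ} (a : Fin n → ZMod 2)
    (v : EuclideanSpace ℂ (Fin n → ZMod 2)) (x : Fin n → ZMod 2) :
    Matrix.toEuclideanLin (pauliX a) v x = v (x + a) := by
  have : ∀ y, x = y + a ↔ y = x + a := fun y => by
    constructor <;> rintro rfl <;> rw [add_assoc, vec_add_self, add_zero]
  rw [Matrix.toEuclideanLin, Matrix.ofLp_toLpLin, Matrix.toLin'_apply, Matrix.mulVec, dotProduct]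
  simp [pauliX, this]

lemma toEuclideanLin_pauliZ_apply {n : ℕ} (b : Fin n → ZMod 2)
    (v : EuclideanSpace ℂ (Fin n → ZMod 2)) (x : Fin n → ZMod 2) :
    Matrix.toEuclideanLin (pauliZ b) v x = zsign (b ⬝ᵥ x) * v x := by
  rw [Matrix.toEuclideanLin, Matrix.ofLp_toLpLin, Matrix.toLin'_apply, pauliZ_eq, Matrix.mulVec_diagonal]

variable {m : ℕ}

lemma mem_codeSpace_qrm {v : EuclideanSpace ℂ (Fin (2 ^ m - 1) → ZMod 2)} :
    v ∈ codeSpace (qrm m) ↔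
      (∀ (T : ShortRow 1 m) x, v (x + mono T.1) = v x) ∧
      ∀ (T : ShortRow (m - 2) m) x, zsign (mono T.1 ⬝ᵥ x) * v x = v x := by
  rw [codeSpace, mem_syndromeSpace_iff, Sum.forall]
  refine and_congr (forall_congr' fun T => ?_) (forall_congr' fun T => ?_)
  · rw [Pi.zero_apply, zsign_zero, one_smul, qrm_inl, pauli_zero_right, PiLp.ext_iff]
    simp_rw [toEuclideanLin_pauliX_apply]
  · rw [Pi.zero_apply, zsign_zero, one_smul, qrm_inr, pauli_zero_left, PiLp.ext_iff]
    simp_rw [toEuclideanLin_pauliZ_apply]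

lemma apply_add_of_mem_codeSpace {v : EuclideanSpace ℂ (Fin (2 ^ m - 1) → ZMod 2)}
    (hv : v ∈ codeSpace (qrm m)) {a : Fin (2 ^ m - 1) → ZMod 2} (ha : a ∈ rmSpan 1 m)
    (x : Fin (2 ^ m - 1) → ZMod 2) : v (x + a) = v x := by
  induction ha using Submodule.span_induction generalizing x with
  | mem y hy =>
    obtain ⟨T, rfl⟩ := hy
    rw [shortGen_eq]
    exact (mem_codeSpace_qrm.mp hv).1 T x
  | zero => rw [add_zero]
  | add y z _ _ h1 h2 => rw [← add_assoc, h2, h1]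
  | smul c y _ h1 =>
    rcases zmod_two_cases c with rfl | rfl
    · rw [zero_smul, add_zero]
    · rw [one_smul, h1]

/-- The Z checks confine the support to the affine functions, that is, to the cosets of 0 and of the
all-ones word. -/
lemma exists_mem_rmSpan_of_apply_ne_zero (hm : 2 ≤ m)
    {v : EuclideanSpace ℂ (Fin (2 ^ m - 1) → ZMod 2)} (hv : v ∈ codeSpace (qrm m))
    {x : Fin (2 ^ m - 1) → ZMod 2} (hx : v x ≠ 0) :
    ∃ a ∈ rmSpan 1 m, x = 0 + a ∨ x = 1 + a := by
  obtain ⟨c, l, rfl⟩ := exists_affine_of_orthogonal hm (x := x) fun T hT hc => by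
    have := (mul_eq_right₀ hx).mp ((mem_codeSpace_qrm.mp hv).2 ⟨T, hT, hc⟩ x)
    exact zsign_injective (this.trans zsign_zero.symm)
  refine ⟨∑ i, l i • mono {i}, Submodule.sum_mem _ fun i _ => Submodule.smul_mem _ _
    (mono_mem_rmSpan (Finset.singleton_nonempty i) (by simp)), ?_⟩
  rcases zmod_two_cases c with rfl | rfl
  · rw [zero_smul]; exact Or.inl rfl
  · rw [one_smul]; exact Or.inr rfl

lemma one_notMem_rmSpan {r : ℕ} (hr : r < m) : (1 : Fin (2 ^ m - 1) → ZMod 2) ∉ rmSpan r m := by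
  intro h
  have := rmSpan_dotProduct_one hr h
  rw [one_dotProduct_one (by omega)] at this
  exact one_ne_zero this

/-- The code space is parametrized by the amplitudes of `|0…0⟩` and `|1…1⟩`. -/
noncomputable def amplitudes (m : ℕ) : codeSpace (qrm m) →ₗ[ℂ] ℂ × ℂ where
  toFun v := (v.1 0, v.1 1)
  map_add' _ _ := rfl
  map_smul' _ _ := rfl

lemma amplitudes_bijective (hm : 2 ≤ m) : Function.Bijective (amplitudes m) := by
  classical
  constructor
  · rw [← LinearMap.ker_eq_bot, LinearMap.ker_eq_bot']
    rintro ⟨v, hv⟩ h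
    obtain ⟨h0, h1⟩ := Prod.mk.inj h
    refine Subtype.ext (PiLp.ext fun x => ?_)
    by_contra hx
    obtain ⟨a, ha, rfl | rfl⟩ := exists_mem_rmSpan_of_apply_ne_zero hm hv hx
    · exact hx ((apply_add_of_mem_codeSpace hv ha 0).trans h0)
    · exact hx ((apply_add_of_mem_codeSpace hv ha 1).trans h1)
  · rintro ⟨α, β⟩
    -- Constant on each of the two cosets. They are distinct because words of the span have even
    -- weight while n is odd.
    let v : EuclideanSpace ℂ (Fin (2 ^ m - 1) → ZMod 2) := WithLp.toLp 2 fun x =>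
      if x ∈ rmSpan 1 m then α else if x + 1 ∈ rmSpan 1 m then β else 0
    have hvx : ∀ x, v x = if x ∈ rmSpan 1 m then α else if x + 1 ∈ rmSpan 1 m then β else 0 :=
      fun _ => rfl
    refine ⟨⟨v, mem_codeSpace_qrm.mpr ⟨fun T x => ?_, fun T x => ?_⟩⟩, ?_⟩
    · have hT := mono_mem_rmSpan T.2.1 T.2.2
      rw [hvx, hvx, add_right_comm, Submodule.add_mem_iff_left _ hT,
        Submodule.add_mem_iff_left _ hT]
    · have hT := mono_mem_rmSpan T.2.1 T.2.2
      rw [hvx]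
      split_ifs with h1 h2
      · rw [rmSpan_dotProduct_rmSpan (by omega) hT h1, zsign_zero, one_mul]
      · have := rmSpan_dotProduct_rmSpan (by omega) hT h2
        rw [dotProduct_add, rmSpan_dotProduct_one (by omega) hT, add_zero] at this
        rw [this, zsign_zero, one_mul]
      · rw [mul_zero]
    · refine Prod.ext ?_ ?_
      · exact (hvx 0).trans (if_pos (zero_mem _))
      · refine (hvx 1).trans ?_
        rw [if_neg (one_notMem_rmSpan (by omega)), vec_add_self, if_pos (zero_mem _)]

lemma finrank_codeSpace_qrm (hm : 2 ≤ m) : Module.finrank ℂ (codeSpace (qrm m)) = 2 := by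
  rw [(LinearEquiv.ofBijective _ (amplitudes_bijective hm)).finrank_eq]
  simp

lemma trace_codeProj_qrm (hm : 2 ≤ m) : (codeProj (qrm m)).trace = 2 := by
  rw [codeProj, trace_syndromeProj]
  exact_mod_cast finrank_codeSpace_qrm hm

lemma codeProj_qrm_ne_zero (hm : 2 ≤ m) : codeProj (qrm m) ≠ 0 := by
  intro h
  have := trace_codeProj_qrm hm
  rw [h, Matrix.trace_zero] at this
  exact two_ne_zero this.symm

/-- The quantum Reed–Muller code has parameters `[[2^m - 1, 1, 3]]`. -/
theorem isStabilizerCode_qrm (hm : 3 ≤ m) : IsStabilizerCode (qrm m) 1 3 := by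
  refine ⟨?_, commute_qrm (by omega), neg_one_notMem_stabilizer (codeProj_qrm_ne_zero (by omega)),
    by rw [finrank_codeSpace_qrm (by omega), pow_one], isLeast_logical_weight hm⟩
  rintro (T | T)
  · rw [qrm_inl]; exact isPauli_pauli _ _
  · rw [qrm_inr]; exact isPauli_pauli _ _

/-! ### The projected interaction -/

/-- The Pauli operator and its adjoint both preserve the code space, so ΠPΠ equals both PΠ and ΠP.
-/
lemma IsSyndrome.commute_codeProj {n : ℕ} {ι : Type} {g : ι → Op n}
    {σ : (Fin n → ZMod 2) × (Fin n → ZMod 2) →+ (ι → ZMod 2)} (h : IsSyndrome g σ)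
    {a b : Fin n → ZMod 2} (hab : σ (a, b) = 0) : Commute (pauli a b) (codeProj g) := by
  have h1 : codeProj g * (pauli a b * codeProj g) = pauli a b * codeProj g :=
    codeProj_mul_of_forall fun j => by
      rw [h.gen_mul_pauli_mul_codeProj, hab, Pi.zero_apply, zsign_zero, one_smul]
  have h2 : codeProj g * ((pauli a b)ᴴ * codeProj g) = (pauli a b)ᴴ * codeProj g := by
    rw [pauli_conjTranspose, pauliZ_mul_pauliX, smul_mul_assoc, mul_smul_comm, h1]
  have h3 := congrArg Matrix.conjTranspose h2
  simp only [Matrix.conjTranspose_mul, Matrix.conjTranspose_conjTranspose,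
    codeProj_conjTranspose] at h3
  rw [commute_iff_eq, ← h1, ← h3, mul_assoc]

lemma qrmSyndrome_logicalZ (hm : 2 ≤ m) : qrmSyndrome m (0, 1) = 0 :=
  qrmSyndrome_eq_zero.mpr ⟨mono_singleton_dotProduct_one hm, fun _ _ _ => dotProduct_zero _⟩

lemma qrmSyndrome_logicalX (hm : 2 ≤ m) : qrmSyndrome m (1, 0) = 0 :=
  qrmSyndrome_eq_zero.mpr ⟨fun _ => dotProduct_zero _,
    fun _ hT hc => mono_dotProduct_one hT (by omega)⟩

lemma commute_logicalZ_codeProj (hm : 2 ≤ m) : Commute (logicalZ m) (codeProj (qrm m)) := by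
  have := (isSyndrome_qrm m).commute_codeProj (qrmSyndrome_logicalZ hm)
  rwa [pauli_zero_left] at this

lemma commute_logicalX_codeProj (hm : 2 ≤ m) : Commute (pauliX 1) (codeProj (qrm m)) := by
  have := (isSyndrome_qrm m).commute_codeProj (qrmSyndrome_logicalX hm)
  rwa [pauli_zero_right] at this

/-- The terms of `G` that are logical operators act as the logical `Z`; the others vanish within
the code space. -/
lemma codeProj_zzz_codeProj (hm : 2 ≤ m) :
    codeProj (qrm m) * zzz (2 ^ m - 1) * codeProj (qrm m) =
      ((lines m).card : ℂ) • (logicalZ m * codeProj (qrm m)) := by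
  classical
  have hterm : ∀ T ∈ Finset.powersetCard 3 (Finset.univ : Finset (Fin (2 ^ m - 1))),
      codeProj (qrm m) * zString T * codeProj (qrm m) =
        if ∀ i, mono {i} ⬝ᵥ ind T = 0 then logicalZ m * codeProj (qrm m) else 0 := by
    intro T hT
    have hc := (Finset.mem_powersetCard.mp hT).2
    split_ifs with h
    · have hT : T ∈ lines m := mem_lines.mpr ⟨hc, h⟩
      -- The string of a line is the logical Z times a stabilizer, and the stabilizer is absorbed by
      -- Π.
      rw [zString_eq, ← logicalZ_mul_pauliZ, mul_assoc, mul_assoc,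
        stabilizer_mul_codeProj (pauliZ_add_one_mem_stabilizer hm hT), ← mul_assoc,
        ← (commute_logicalZ_codeProj hm).eq, mul_assoc, codeProj_mul_self]
    · rw [zString_eq, ← pauli_zero_left]
      refine (isSyndrome_qrm m).codeProj_mul_pauli_mul_codeProj fun h0 => h ?_
      exact (qrmSyndrome_eq_zero.mp h0).1
  rw [zzz, Finset.mul_sum, Finset.sum_mul, Finset.sum_congr rfl hterm, ← Finset.sum_filter,
    Finset.sum_const, ← Nat.cast_smul_eq_nsmul ℂ]
  simp only [lines]

end CodeSpace

/-! ### Unitary evolution and quantum Fisher information -/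

section Fisher

variable {n : ℕ}

/-- The commutator generator `ρ ↦ -i [K, ρ]` as a continuous linear map. -/
noncomputable def commGen (K : Op n) : Op n →L[ℂ] Op n :=
  LinearMap.toContinuousLinearMap (lindbladian K (q := 0) Fin.elim0)

lemma commGen_apply (K ρ : Op n) : commGen K ρ = (-Complex.I) • (K * ρ - ρ * K) :=
  lindbladian_elim0_apply K ρ

/-- The parameter enters linearly, so the family is a one-parameter group in it and can be
differentiated as such. -/
lemma evolve_effGenerator {ι : Type} (g : ι → Op n) (w t : ℝ) (ρ : Op n) :
    evolve (effGenerator g w) t ρ =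
      NormedSpace.exp (w • (t • commGen (codeProj g * zzz n * codeProj g))) ρ := by
  have : LinearMap.toContinuousLinearMap (effGenerator g w) =
      w • commGen (codeProj g * zzz n * codeProj g) := by
    ext1 x
    rw [smul_apply, commGen_apply, LinearMap.coe_toContinuousLinearMap',
      effGenerator, lindbladian_elim0_apply, smul_mul_assoc, mul_smul_comm, ← smul_sub, smul_comm]
  rw [evolve, this, smul_comm]

lemma hasDerivAt_evolve {ι : Type} (g : ι → Op n) (ω t : ℝ) (ρ : Op n) :
    HasDerivAt (fun w => evolve (effGenerator g w) t ρ)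
      (t • commGen (codeProj g * zzz n * codeProj g) (evolve (effGenerator g ω) t ρ)) ω := by
  simp_rw [evolve_effGenerator]
  have h := (hasDerivAt_exp_smul_const' (𝕂 := ℝ)
    (t • commGen (codeProj g * zzz n * codeProj g)) ω)
  exact ((ContinuousLinearMap.apply ℂ (Op n) ρ).restrictScalars ℝ).hasFDerivAt.comp_hasDerivAt ω h

/-- The flow of `-i [K, ·]` is conjugation by a unitary that commutes with `K`. -/
lemma exists_unitary_exp_commGen {K : Op n} (hK : Kᴴ = K) (s : ℝ) (ρ : Op n) :
    ∃ W : Op n, Wᴴ * W = 1 ∧ W * Wᴴ = 1 ∧ Commute W K ∧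
      NormedSpace.exp (s • commGen K) ρ = W * ρ * Wᴴ := by
  let _ : NormedAlgebra ℚ (Op n) := NormedAlgebra.restrictScalars ℚ ℂ _
  set A : Op n := Complex.I • K with hA
  have hAs : ∀ r : ℝ, (r • A)ᴴ = (-r) • A := fun r => by
    rw [hA, Matrix.conjTranspose_smul, Matrix.conjTranspose_smul, hK]
    simp
  have hstar : ∀ r : ℝ, (NormedSpace.exp (r • A))ᴴ = NormedSpace.exp ((-r) • A) := fun r => by
    rw [← hAs]
    exact NormedSpace.star_exp _
  have hinv : ∀ r : ℝ, NormedSpace.exp (r • A) * NormedSpace.exp ((-r) • A) = 1 := fun r => by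
    rw [← NormedSpace.exp_add_of_commute (((Commute.refl A).smul_left r).smul_right (-r)),
      ← add_smul, add_neg_cancel, zero_smul, NormedSpace.exp_zero]
  have hinv' : ∀ r : ℝ, NormedSpace.exp ((-r) • A) * NormedSpace.exp (r • A) = 1 := fun r => by
    simpa using hinv (-r)
  -- Interaction picture: undoing the expected conjugation leaves a function with zero derivative,
  -- hence the constant ρ. The unitary is exp (-isK).
  set f : ℝ → Op n := fun r => NormedSpace.exp (r • A) * NormedSpace.exp (r • commGen K) ρ *
    NormedSpace.exp ((-r) • A) with hf
  have hderiv : ∀ r, HasDerivAt f 0 r := by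
    intro r
    have h1 := hasDerivAt_exp_smul_const (𝕂 := ℝ) A r
    have h2 : HasDerivAt (fun r : ℝ => NormedSpace.exp (r • commGen K) ρ)
        (commGen K (NormedSpace.exp (r • commGen K) ρ)) r :=
      ((ContinuousLinearMap.apply ℂ (Op n) ρ).restrictScalars ℝ).hasFDerivAt.comp_hasDerivAt r
        (hasDerivAt_exp_smul_const' (𝕂 := ℝ) (commGen K) r)
    have h3 : HasDerivAt (fun r : ℝ => NormedSpace.exp ((-r) • A))
        (-(A * NormedSpace.exp ((-r) • A))) r := by
      simpa [neg_smul, ← smul_neg] using hasDerivAt_exp_smul_const' (𝕂 := ℝ) (-A) r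
    refine ((h1.mul h2).mul h3).congr_deriv ?_
    rw [Pi.mul_apply, commGen_apply]
    generalize NormedSpace.exp (r • commGen K) ρ = x
    simp only [hA, mul_smul_comm, smul_mul_assoc, mul_sub, sub_mul, smul_sub, add_mul, neg_smul,
      mul_neg, neg_mul, mul_assoc]
    abel
  have hconst : f s = f 0 :=
    is_const_of_deriv_eq_zero (fun r => (hderiv r).differentiableAt)
      (fun r => (hderiv r).deriv) s 0
  have hf0 : f 0 = ρ := by
    have h0 : NormedSpace.exp ((0 : ℝ) • commGen K) = 1 :=
      (congrArg NormedSpace.exp (zero_smul ℝ (commGen K))).trans NormedSpace.exp_zero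
    simp [hf, h0, NormedSpace.exp_zero]
  refine ⟨NormedSpace.exp ((-s) • A), ?_, ?_, ?_, ?_⟩
  · rw [hstar, neg_neg, hinv]
  · rw [hstar, neg_neg, hinv']
  · have : Commute ((-s) • A) K := ((Commute.refl K).smul_left Complex.I).smul_left (-s)
    exact this.exp_left
  · rw [hstar, neg_neg]
    have hconj : NormedSpace.exp (s • A) * NormedSpace.exp (s • commGen K) ρ *
        NormedSpace.exp ((-s) • A) = ρ := hconst.trans hf0
    conv_rhs => rw [← hconj]
    simp only [mul_assoc]
    rw [hinv', mul_one, ← mul_assoc, hinv', one_mul]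

/-- The quantum Fisher information of a unitary family is at most four times the second moment of
the generator. -/
lemma fisher_le {ρ K L : Op n} (hρ : ρ.PosSemidef) (hK : Kᴴ = K) (hL : L.IsHermitian) {t F V : ℝ}
    (hLρ : (1 / 2 : ℂ) • (L * ρ + ρ * L) = t • commGen K ρ)
    (hF : (F : ℂ) = (ρ * (L * L)).trace) (hV : (ρ * (K * K)).trace = V) : F ≤ 4 * t ^ 2 * V := by
  have h1 : (F : ℂ) = -(Complex.I * t) * ((ρ * (L * K)).trace - (ρ * (K * L)).trace) := by
    have h := congrArg (fun M : Op n => (M * L).trace) hLρ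
    simp only [commGen_apply, smul_mul_assoc, Matrix.trace_smul, add_mul, sub_mul,
      Matrix.trace_add, Matrix.trace_sub, mul_assoc] at h
    rw [Matrix.trace_mul_comm L (ρ * L), mul_assoc, ← hF, Matrix.trace_mul_comm K (ρ * L),
      mul_assoc] at h
    rw [Complex.real_smul, smul_eq_mul, smul_eq_mul] at h
    linear_combination h
  -- Positivity of Tr(M ρ Mᴴ) is the bound: its cross terms equal -2F by the equation for L, which
  -- leaves 4t²V - F.
  set M : Op n := L + (2 * t * Complex.I) • K with hM
  have hMs : Mᴴ = L - (2 * t * Complex.I) • K := by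
    rw [hM, Matrix.conjTranspose_add, Matrix.conjTranspose_smul, hL.eq, hK, sub_eq_add_neg,
      ← neg_smul]
    simp
  have h2 := (hρ.mul_mul_conjTranspose_same M).trace_nonneg
  rw [mul_assoc, Matrix.trace_mul_comm, mul_assoc, hMs, hM] at h2
  have h3 : (ρ * ((L - (2 * t * Complex.I) • K) * (L + (2 * t * Complex.I) • K))).trace =
      ((4 * t ^ 2 * V - F : ℝ) : ℂ) := by
    simp only [mul_add, sub_mul, mul_sub, smul_mul_assoc, mul_smul_comm, Matrix.trace_add,
      Matrix.trace_sub, Matrix.trace_smul, smul_eq_mul, ← hF, hV]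
    push_cast
    linear_combination (2 : ℂ) * h1 - 4 * (t : ℂ) ^ 2 * V * Complex.I_sq
  rw [h3] at h2
  have := Complex.zero_le_real.mp h2
  linarith

/-- A symmetric logarithmic derivative of a pure state evolving under a generator of mean zero. -/
lemma exists_sld {ρ K : Op n} (hρ : ρᴴ = ρ) (hρρ : ρ * ρ = ρ) (hK : Kᴴ = K) (h0 : ρ * K * ρ = 0)
    {t V : ℝ} (hV : (ρ * (K * K)).trace = V) :
    ∃ L : Op n, L.IsHermitian ∧ t • commGen K ρ = (1 / 2 : ℂ) • (L * ρ + ρ * L) ∧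
      ((4 * t ^ 2 * V : ℝ) : ℂ) = (ρ * (L * L)).trace := by
  set D : Op n := K * ρ - ρ * K with hD
  have hDs : Dᴴ = -D := by
    rw [hD, Matrix.conjTranspose_sub, Matrix.conjTranspose_mul, Matrix.conjTranspose_mul, hK, hρ,
      neg_sub]
  have h1 : ρ * D = -(ρ * K) := by
    rw [hD, mul_sub, ← mul_assoc, h0, ← mul_assoc, hρρ, zero_sub]
  have h2 : D * ρ = K * ρ := by
    rw [hD, sub_mul, h0, mul_assoc, hρρ, sub_zero]
  have hLdef : ∀ c : ℂ, (c • D) * ρ + ρ * (c • D) = c • D := fun c => by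
    rw [smul_mul_assoc, mul_smul_comm, ← smul_add, h1, h2, ← sub_eq_add_neg]
  -- Twice the derivative of the state: differentiating ρ² = ρ shows that this is a logarithmic
  -- derivative for a pure state.
  refine ⟨(-(2 * t * Complex.I)) • D, ?_, ?_, ?_⟩
  · rw [Matrix.IsHermitian, Matrix.conjTranspose_smul, hDs]
    simp
  · rw [hLdef, commGen_apply, ← hD, smul_smul, ← Complex.coe_smul, smul_smul]
    congr 1
    ring
  · have h3 : ρ * (D * D) = -(ρ * (K * K) * ρ) := by
      rw [← mul_assoc, h1, hD, mul_sub, neg_mul, neg_mul]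
      have : ρ * K * (ρ * K) = 0 := by rw [← mul_assoc, h0, zero_mul]
      rw [this, neg_zero, sub_zero]
      simp only [mul_assoc]
    rw [smul_mul_assoc, mul_smul_comm, mul_smul_comm, mul_smul_comm, smul_smul, h3,
      Matrix.trace_smul, Matrix.trace_neg, Matrix.trace_mul_comm _ ρ, ← mul_assoc, hρρ, hV]
    push_cast
    rw [smul_eq_mul]
    linear_combination (4 * (t : ℂ) ^ 2 * V) * Complex.I_sq

end Fisher

/-! ### The quantum Fisher information of the quantum Reed–Muller code -/

section CodeFisher

variable {m : ℕ}

lemma logicalZ_conjTranspose : (logicalZ m)ᴴ = logicalZ m := pauliZ_conjTranspose _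

lemma logicalZ_mul_self : logicalZ m * logicalZ m = 1 := by
  rw [logicalZ, pauliZ_mul, vec_add_self, pauliZ_zero]

lemma logicalZ_mul_logicalX (hm : 0 < m) :
    logicalZ m * pauliX 1 = -(pauliX 1 * logicalZ m) := by
  rw [logicalZ, pauliZ_mul_pauliX, one_dotProduct_one hm, zsign_one, neg_one_smul, pauli]

/-- The projected interaction `Π G Π`. -/
noncomputable def effInt (m : ℕ) : Op (2 ^ m - 1) :=
  codeProj (qrm m) * zzz (2 ^ m - 1) * codeProj (qrm m)

lemma effInt_eq (hm : 2 ≤ m) :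
    effInt m = ((lines m).card : ℂ) • (logicalZ m * codeProj (qrm m)) :=
  codeProj_zzz_codeProj hm

lemma effInt_conjTranspose (hm : 2 ≤ m) : (effInt m)ᴴ = effInt m := by
  rw [effInt_eq hm, Matrix.conjTranspose_smul, Matrix.conjTranspose_mul, codeProj_conjTranspose,
    logicalZ_conjTranspose, (commute_logicalZ_codeProj hm).eq]
  simp

lemma effInt_mul_self (hm : 2 ≤ m) :
    effInt m * effInt m = (((lines m).card : ℂ) ^ 2) • codeProj (qrm m) := by
  rw [effInt_eq hm, smul_mul_smul_comm, ← sq, mul_assoc, ← mul_assoc (codeProj (qrm m)),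
    ← (commute_logicalZ_codeProj hm).eq, mul_assoc (logicalZ m), codeProj_mul_self, ← mul_assoc,
    logicalZ_mul_self, one_mul]

/-- The squared generator is a multiple of Π, so its mean does not depend on the code state. -/
lemma trace_mul_effInt_sq (hm : 2 ≤ m) {ρ : Op (2 ^ m - 1)} (hρ : IsCodeState (qrm m) ρ) :
    (ρ * (effInt m * effInt m)).trace = (((lines m).card : ℝ) ^ 2 : ℝ) := by
  rw [effInt_mul_self hm, mul_smul_comm, IsCodeOp.mul_codeProj hρ.2.2, Matrix.trace_smul, hρ.2.1]
  simp

/-- The code state `|+⟩⟨+|`. -/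
noncomputable def plusState (m : ℕ) : Op (2 ^ m - 1) :=
  (1 / 2 : ℂ) • (codeProj (qrm m) * (1 + pauliX 1))

lemma logicalX_mul_self : (pauliX 1 : Op (2 ^ m - 1)) * pauliX 1 = 1 := by
  rw [pauliX_mul, vec_add_self, pauliX_zero]

lemma commute_plus (hm : 2 ≤ m) : Commute (1 + pauliX 1) (codeProj (qrm m)) :=
  (Commute.one_left _).add_left (commute_logicalX_codeProj hm)

lemma plusState_conjTranspose (hm : 2 ≤ m) : (plusState m)ᴴ = plusState m := by
  rw [plusState, Matrix.conjTranspose_smul, Matrix.conjTranspose_mul, codeProj_conjTranspose,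
    Matrix.conjTranspose_add, pauliX_conjTranspose, Matrix.conjTranspose_one, (commute_plus hm).eq]
  simp

lemma codeProj_mul_plusState : codeProj (qrm m) * plusState m = plusState m := by
  rw [plusState, mul_smul_comm, ← mul_assoc, codeProj_mul_self]

lemma plusState_mul_codeProj (hm : 2 ≤ m) : plusState m * codeProj (qrm m) = plusState m := by
  rw [plusState, smul_mul_assoc, mul_assoc, (commute_plus hm).eq, ← mul_assoc, codeProj_mul_self]

lemma plusState_mul_self (hm : 2 ≤ m) : plusState m * plusState m = plusState m := by
  have hS : plusState m = (1 / 2 : ℂ) • ((1 + pauliX 1) * codeProj (qrm m)) := by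
    rw [plusState, (commute_plus hm).eq]
  nth_rewrite 1 [hS]
  rw [smul_mul_assoc, mul_assoc, codeProj_mul_plusState, hS, mul_smul_comm, ← mul_assoc]
  have : (1 + pauliX 1 : Op (2 ^ m - 1)) * (1 + pauliX 1) = (2 : ℂ) • (1 + pauliX 1) := by
    rw [mul_add, mul_one, add_mul, one_mul, logicalX_mul_self, two_smul,
      add_comm (pauliX 1) (1 : Op (2 ^ m - 1))]
  rw [this, smul_mul_assoc, smul_smul (1 / 2 : ℂ) 2]
  norm_num

lemma isCodeState_plusState (hm : 2 ≤ m) : IsCodeState (qrm m) (plusState m) := by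
  refine ⟨?_, ?_, by rw [codeProj_mul_plusState, plusState_mul_codeProj hm]⟩
  · have := Matrix.posSemidef_conjTranspose_mul_self (plusState m)
    rwa [plusState_conjTranspose hm, plusState_mul_self hm] at this
  · have hX : (codeProj (qrm m) * pauliX 1).trace = 0 := by
      have h1 : codeProj (qrm m) * pauliX 1 =
          logicalZ m * (logicalZ m * (codeProj (qrm m) * pauliX 1)) := by
        rw [← mul_assoc, logicalZ_mul_self, one_mul]
      have h2 : (codeProj (qrm m) * pauliX 1).trace = -(codeProj (qrm m) * pauliX 1).trace := by
        conv_lhs => rw [h1]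
        rw [Matrix.trace_mul_comm, ← mul_assoc, (commute_logicalZ_codeProj hm).eq, mul_assoc,
          mul_assoc, ← mul_assoc (logicalZ m), logicalZ_mul_logicalX (by omega), neg_mul,
          mul_assoc, logicalZ_mul_self, mul_one, mul_neg, Matrix.trace_neg]
      linear_combination (1 / 2 : ℂ) * h2
    rw [plusState, Matrix.trace_smul, mul_add, mul_one, Matrix.trace_add, hX,
      trace_codeProj_qrm hm]
    norm_num

/-- The logical Z turns |+⟩ into |-⟩, so the interaction has mean zero in this state. -/
lemma plusState_mul_effInt_mul_plusState (hm : 2 ≤ m) :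
    plusState m * effInt m * plusState m = 0 := by
  have h : (1 + pauliX 1 : Op (2 ^ m - 1)) * (logicalZ m * (1 + pauliX 1)) = 0 := by
    rw [mul_add, mul_one, logicalZ_mul_logicalX (by omega), add_mul, one_mul, mul_add, mul_neg,
      ← mul_assoc, logicalX_mul_self, one_mul]
    abel
  rw [effInt_eq hm, mul_smul_comm, smul_mul_assoc, mul_assoc, mul_assoc, codeProj_mul_plusState]
  have : plusState m * (logicalZ m * plusState m) = 0 := by
    rw [plusState, ← (commute_plus hm).eq, mul_smul_comm, smul_mul_smul_comm,
      (commute_plus hm).eq, mul_assoc, ← (commute_plus hm).eq, ← mul_assoc (logicalZ m),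
      ← mul_assoc (1 + pauliX 1), h, zero_mul, mul_zero, smul_zero]
  rw [this, smul_zero]

/-- The largest quantum Fisher information over the initial code states. -/
theorem isGreatest_codeQFIs (hm : 2 ≤ m) (ω t : ℝ) :
    IsGreatest (codeQFIs (qrm m) ω t) (4 * t ^ 2 * ((lines m).card : ℝ) ^ 2) := by
  have hK := effInt_conjTranspose hm
  have hev : ∀ ρ : Op (2 ^ m - 1), ∃ W : Op (2 ^ m - 1), Wᴴ * W = 1 ∧ W * Wᴴ = 1 ∧
      Commute W (effInt m) ∧ evolve (effGenerator (qrm m) ω) t ρ = W * ρ * Wᴴ := by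
    intro ρ
    obtain ⟨W, h1, h2, h3, h4⟩ := exists_unitary_exp_commGen hK (ω * t) ρ
    exact ⟨W, h1, h2, h3, by rw [evolve_effGenerator, smul_smul]; exact h4⟩
  -- The evolution commutes with its generator, so the second moment keeps its initial value.
  have hmoment : ∀ {ρ W : Op (2 ^ m - 1)}, IsCodeState (qrm m) ρ → Wᴴ * W = 1 →
      Commute W (effInt m) →
      (W * ρ * Wᴴ * (effInt m * effInt m)).trace = (((lines m).card : ℝ) ^ 2 : ℝ) := by
    intro ρ W hρ h1 h3
    rw [← trace_mul_effInt_sq hm hρ, mul_assoc, mul_assoc, Matrix.trace_mul_comm, mul_assoc,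
      mul_assoc, ← (h3.mul_right h3).eq, ← mul_assoc Wᴴ, h1, one_mul]
  constructor
  · obtain ⟨W, h1, h2, h3, h4⟩ := hev (plusState m)
    have hs := isCodeState_plusState hm
    obtain ⟨L, hL, hd, hF⟩ := exists_sld (ρ := W * plusState m * Wᴴ) (K := effInt m)
      (by simp only [Matrix.conjTranspose_mul, Matrix.conjTranspose_conjTranspose,
            plusState_conjTranspose hm, mul_assoc])
      (by
        calc W * plusState m * Wᴴ * (W * plusState m * Wᴴ)
            = W * plusState m * (Wᴴ * W) * plusState m * Wᴴ := by simp only [mul_assoc]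
          _ = _ := by rw [h1, mul_one, mul_assoc W, plusState_mul_self hm]) hK
      (by
        calc W * plusState m * Wᴴ * effInt m * (W * plusState m * Wᴴ)
            = W * plusState m * Wᴴ * (effInt m * W) * plusState m * Wᴴ := by
              simp only [mul_assoc]
          _ = W * plusState m * (Wᴴ * W) * effInt m * plusState m * Wᴴ := by
              rw [← h3.eq]; simp only [mul_assoc]
          _ = W * (plusState m * effInt m * plusState m) * Wᴴ := by
              rw [h1]; simp only [mul_assoc, one_mul]
          _ = 0 := by rw [plusState_mul_effInt_mul_plusState hm, mul_zero, zero_mul])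
      (t := t) (hmoment hs h1 h3)
    refine ⟨plusState m, hs, L, hL, ?_, ?_⟩
    · beta_reduce
      rw [h4, ← hd, ← h4]
      exact hasDerivAt_evolve (qrm m) ω t (plusState m)
    · beta_reduce
      rw [h4]
      exact hF
  · rintro F ⟨ρ, hρ, L, hL, hd, hF⟩
    obtain ⟨W, h1, h2, h3, h4⟩ := hev ρ
    have hd' := hd.unique (hasDerivAt_evolve (qrm m) ω t ρ)
    beta_reduce at hd' hF
    rw [h4] at hd' hF
    exact fisher_le (hρ.1.mul_mul_conjTranspose_same W) hK hL hd' hF (hmoment hρ h1 h3)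

end CodeFisher

end QRM

/-! ### The main theorem -/

theorem theorem2 :
    (∀ m n : ℕ, 3 ≤ m → n = 2 ^ m - 1 →
      -- `QRM(1,m)` is an `[[n, 1, 3]]` stabilizer code, and `Z^{⊗ n}` is a logical operator of it
      IsStabilizerCode (qrm m) 1 3 ∧
      IsLogical (qrm m) (logicalZ m) ∧
      -- the logical `Z` has `n (n - 1) / 6` representatives of weight 3
      6 * {P | IsPauliOfWeight 3 P ∧ ∃ Q ∈ stabilizer (qrm m), P = logicalZ m * Q}.ncard
        = n * (n - 1) ∧
      -- they are as many as the terms `Z_i Z_j Z_k` of `G` that are logical operators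
      6 * {T : Finset (Fin (2 ^ m - 1)) | T.card = 3 ∧ IsLogical (qrm m) (zString T)}.ncard
        = n * (n - 1) ∧
      -- with suitable Pauli corrections, frequent syndrome measurements under any single-qubit noise
      -- and any 2-local `H₀` lead, in the limit, to the evolution by `ω Π G Π` on the code
      (∃ C : (ShortRow 1 m ⊕ ShortRow (m - 2) m → ZMod 2) → Op (2 ^ m - 1),
        (∀ s, IsPauli (C s)) ∧
        ∀ (q : ℕ) (L : Fin q → Op (2 ^ m - 1)) (H₀ : Op (2 ^ m - 1)),
          (∀ a, ∃ i, L a ∈ supportedOn {i}) → H₀.IsHermitian → H₀ ∈ localOps (2 ^ m - 1) 2 →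
          ∀ (ω t : ℝ) (ρ₀ : Op (2 ^ m - 1)), 0 ≤ t → IsCodeState (qrm m) ρ₀ →
            Filter.Tendsto
              (fun N : ℕ => controlled (recovery (qrm m) C)
                (lindbladian (ω • zzz (2 ^ m - 1) + H₀) L) t N ρ₀)
              Filter.atTop (𝓝 (evolve (effGenerator (qrm m) ω) t ρ₀))) ∧
      -- the largest quantum Fisher information over the initial code states
      (∀ ω t : ℝ, 0 ≤ t →
        IsGreatest (codeQFIs (qrm m) ω t) ((n : ℝ) ^ 2 * ((n : ℝ) - 1) ^ 2 * t ^ 2 / 9) ∧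
        codeQFI (qrm m) ω t = (n : ℝ) ^ 2 * ((n : ℝ) - 1) ^ 2 * t ^ 2 / 9)) ∧
    -- the `Θ(n⁴ t²)` scaling
    (∃ c₁ c₂ : ℝ, 0 < c₁ ∧ 0 < c₂ ∧ ∀ m n : ℕ, 3 ≤ m → n = 2 ^ m - 1 → ∀ ω t : ℝ, 0 ≤ t →
      c₁ * ((n : ℝ) ^ 4 * t ^ 2) ≤ codeQFI (qrm m) ω t ∧
      codeQFI (qrm m) ω t ≤ c₂ * ((n : ℝ) ^ 4 * t ^ 2)) := by

  have hcast : ∀ m n : ℕ, 3 ≤ m → n = 2 ^ m - 1 → 6 * (lines m).card = n * (n - 1) := by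
    rintro m n _ rfl
    exact six_mul_card_lines m
  have hn : ∀ m n : ℕ, 3 ≤ m → n = 2 ^ m - 1 → 7 ≤ n := by
    rintro m n hm rfl
    have : 2 ^ 3 ≤ 2 ^ m := Nat.pow_le_pow_right two_pos hm
    omega
  -- With n(n-1)/6 lines, the factor 4/36 becomes 1/9.
  have hval : ∀ m n : ℕ, 3 ≤ m → n = 2 ^ m - 1 → ∀ t : ℝ,
      4 * t ^ 2 * ((lines m).card : ℝ) ^ 2 = (n : ℝ) ^ 2 * ((n : ℝ) - 1) ^ 2 * t ^ 2 / 9 := by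
    intro m n hm hmn t
    have h := congrArg (Nat.cast : ℕ → ℝ) (hcast m n hm hmn)
    have h1 : 1 ≤ n := by have := hn m n hm hmn; omega
    push_cast [Nat.cast_sub h1] at h
    have h2 : ((lines m).card : ℝ) = n * (n - 1) / 6 := by linarith
    rw [h2]
    ring
  have hqfi : ∀ m n : ℕ, 3 ≤ m → n = 2 ^ m - 1 → ∀ ω t : ℝ,
      IsGreatest (codeQFIs (qrm m) ω t) ((n : ℝ) ^ 2 * ((n : ℝ) - 1) ^ 2 * t ^ 2 / 9) := by
    intro m n hm hmn ω t
    rw [← hval m n hm hmn t]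
    exact isGreatest_codeQFIs (by omega) ω t
  -- Since n ≥ 7, n/2 ≤ n - 1 ≤ n; squaring and dividing by 9 gives the constants 1/36 and 1/9.
  refine ⟨fun m n hm hmn => ⟨isStabilizerCode_qrm hm, isLogical_logicalZ (by omega), ?_, ?_, ?_,
    fun ω t _ => ⟨hqfi m n hm hmn ω t, (hqfi m n hm hmn ω t).csSup_eq⟩⟩, 1 / 36, 1 / 9,
    by norm_num, by norm_num, fun m n hm hmn ω t _ => ?_⟩
  · rw [ncard_representatives hm, hcast m n hm hmn]
  · rw [ncard_logical_zString (by omega), hcast m n hm hmn]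
  · exact ⟨correction (qrmSyndrome m), isPauli_correction, fun q L H₀ hL _ hH ω t ρ _ hρ =>
      (isSyndrome_qrm m).tendsto_controlled (detectsTwo_qrm hm)
        (codeProj_qrm_ne_zero (by omega)) hL hH ω t hρ.2.2⟩
  · rw [codeQFI, (hqfi m n hm hmn ω t).csSup_eq]
    have h7 : (7 : ℝ) ≤ n := by exact_mod_cast hn m n hm hmn
    have hlow : (n : ℝ) ^ 2 ≤ 4 * ((n : ℝ) - 1) ^ 2 := by nlinarith
    have hup : ((n : ℝ) - 1) ^ 2 ≤ (n : ℝ) ^ 2 := by nlinarith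
    have hnn : 0 ≤ (n : ℝ) ^ 2 * t ^ 2 := by positivity
    constructor
    · nlinarith [mul_le_mul_of_nonneg_left hlow hnn]
    · nlinarith [mul_le_mul_of_nonneg_left hup hnn]
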